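/- Let $0<s\le 1$, let $q\ge 1$ and let $b_1,\dots,b_q$ be nonzero real numbers; in particular, these may be the coefficients of Yoshida's composition methods, $q=3^{p-1}$, $p\ge1$. Let $\alpha\ge 1$ be an integer. Functions are complex-valued and $2\pi$-periodic, $\widehat v(l)=\frac1{2\pi}\int_{-\pi}^{\pi}v(x)e^{-ilx}\,dx$, $\|v\|=(\int_{-\pi}^{\pi}|v|^2dx)^{1/2}$, $|v|_\infty=\sup|v|$, $\|v\|_\mu=(\sum_{l\in\mathbb Z}(1+l^2)^\mu|\widehat v(l)|^2)^{1/2}$, and $(-\partial_{xx})^s$ multiplies $\widehat v(l)$ by $|l|^{2s}$. For $N\ge 1$ let $S_N=\mathrm{span}\{e^{ilx}:|l|\le N\}$, let $P_Nv=\sum_{|l|\le N}\widehat v(l)e^{ilx}$ and let $F(v)=-i(-\partial_{xx})^sv+iP_N(|v|^2v)$ for $v\in S_N$. There is $\mu_0$ (depending on $s,q,b,\alpha$) such that the following holds for all $\mu\ge\mu_0$ and $T>0$. Let $u$ solve $$iu_t-(-\partial_{xx})^su+|u|^2u=0\quad(0\le t\le T),\qquad u(0)=u_0,$$ the equation being understood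 as an identity between Fourier coefficients at every time, with $u(t)$ continuous in $x$ and in $H^\mu$ for every $t\in[0,T]$ and $\sup_{0\le t\le T}\|u(t)\|_\mu<\infty$. Let $u^N:[0,T]\to S_N$ be the Fourier–Galerkin semidiscrete solution, $\frac{d}{dt}u^N=F(u^N)$, $u^N(0)=P_Nu_0$. For $M\ge1$ let $k=T/M$ and $t_n=nk$. Given $U^n\in S_N$, one step of the scheme consists of $Y^{n,0},\dots,Y^{n,q}\in S_N$ with $$Y^{n,0}=U^n,\qquad Y^{n,j}=Y^{n,j-1}+kb_jF\Big(\frac{Y^{n,j}+Y^{n,j-1}}2\Big)\ (1\le j\le q),\qquad U^{n+1}=Y^{n,q},$$ starting from $U^0=P_Nu_0$. The local temporal error is $\Theta^n=u^N(t_{n+1})-Z^{n,q}$, where $Z^{n,0},\dots,Z^{n,q}\in S_N$ are the stages of one step started from $Z^{n,0}=u^N(t_n)$. For every constant $C_\Theta$ there is a constant $C$, independent of $N$, $M$ and $k$, such that for all $N,M\ge 1$ with $$3R^2kN\max_{1\le j\le q}|b_j|<1,\qquad \max_{0\le n\le M-1}\|\Theta^n\|\le C_\Theta k^{\alpha+1},$$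 where $R$ is either $\|U^0\|$ or $\max_{0\le t\le T}|u^N(t)|_\infty$, the scheme has a unique solution $(U^n)_{0\le n\le M}$, $(Y^{n,j})_{0\le n<M,\,0\le j\le q}$, and $$\max_{0\le n\le M}\|U^n-u(t_n)\|\le C\,(k^\alpha+N^{-\mu}).$$ -/

import Mathlib

noncomputable section

namespace FNLS

instance factTwoPiPos : Fact (0 < 2 * Real.pi) := ⟨Real.two_pi_pos⟩

/-- Continuous `2π`-periodic complex-valued functions, with the supremum norm. -/
abbrev Per : Type := C(AddCircle (2 * Real.pi), ℂ)

/-- The trigonometric polynomials of degree at most `N`. -/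
def S (N : ℕ) : Submodule ℂ Per :=
  Submodule.span ℂ {e : Per | ∃ l : ℤ, |l| ≤ (N : ℤ) ∧ e = fourier l}

/-- The truncation `P_N v = ∑_{|l| ≤ N} v̂(l) e^{ilx}` of the Fourier series. Mathlib's `fourierCoeff`
is taken with respect to the Haar probability measure, so that
`fourierCoeff v l = (2π)⁻¹ ∫_{-π}^{π} v(x) e^{-ilx} dx`. -/
def proj (N : ℕ) (v : Per) : Per :=
  ∑ l ∈ Finset.Icc (-(N : ℤ)) (N : ℤ), fourierCoeff v l • (fourier l : Per)

/-- The operator `(-∂ₓₓ)^s` on trigonometric polynomials of degree at most `N`. -/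
def fracLap (N : ℕ) (s : ℝ) (v : Per) : Per :=
  ∑ l ∈ Finset.Icc (-(N : ℤ)) (N : ℤ),
    (((|(l : ℝ)| ^ (2 * s) : ℝ) : ℂ) * fourierCoeff v l) • (fourier l : Per)

/-- The cubic nonlinearity `f(v) = |v|² v`. -/
def cubic (v : Per) : Per where
  toFun x := ((‖v x‖ ^ 2 : ℝ) : ℂ) * v x
  continuous_toFun := by fun_prop

/-- The vector field `F(v) = -i (-∂ₓₓ)^s v + i P_N f(v)` on `S N`. -/
def F (N : ℕ) (s : ℝ) (v : Per) : Per :=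
  -(Complex.I • fracLap N s v) + Complex.I • proj N (cubic v)

/-- The norm of `L²(-π, π)` with Lebesgue measure (not normalized). -/
def l2norm (v : Per) : ℝ :=
  Real.sqrt (∫ x in (-Real.pi)..Real.pi, ‖v (x : AddCircle (2 * Real.pi))‖ ^ 2)

/-- Membership in the periodic Sobolev space `H^μ`. -/
def MemSobolev (μ : ℝ) (v : Per) : Prop :=
  Summable fun l : ℤ => (1 + (l : ℝ) ^ 2) ^ μ * ‖fourierCoeff v l‖ ^ 2

/-- The norm of the periodic Sobolev space `H^μ`. -/
def sobolevNorm (μ : ℝ) (v : Per) : ℝ :=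
  Real.sqrt (∑' l : ℤ, (1 + (l : ℝ) ^ 2) ^ μ * ‖fourierCoeff v l‖ ^ 2)

/-- `u` solves `i u_t - (-∂ₓₓ)^s u + |u|² u = 0` on `[0, T]`, `u(0) = u₀`: the equation holds at every
time `t ∈ [0, T]` as an identity between Fourier series, that is,
`d/dt û(l) = -i |l|^{2s} û(l) + i (|u|²u)^(l)` for every `l`. -/
structure IsSolution (s T : ℝ) (u₀ : Per) (u : ℝ → Per) : Prop where
  init : u 0 = u₀
  eqn : ∀ t ∈ Set.Icc 0 T, ∀ l : ℤ,
    HasDerivWithinAt (fun τ => fourierCoeff (u τ) l)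
      (-(Complex.I * ((|(l : ℝ)| ^ (2 * s) : ℝ) : ℂ) * fourierCoeff (u t) l)
        + Complex.I * fourierCoeff (cubic (u t)) l)
      (Set.Icc 0 T) t

/-- `u(t)` lies in `H^μ` for `t ∈ [0, T]`, with `H^μ` norm bounded uniformly in `t`. -/
def BoundedInSobolev (μ T : ℝ) (u : ℝ → Per) : Prop :=
  ∃ B : ℝ, ∀ t ∈ Set.Icc 0 T, MemSobolev μ (u t) ∧ sobolevNorm μ (u t) ≤ B

/-- `uN` is the semidiscrete Fourier-Galerkin approximation of degree `N` on `[0, T]`. -/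
structure IsSemidiscrete (N : ℕ) (s T : ℝ) (u₀ : Per) (uN : ℝ → Per) : Prop where
  mem : ∀ t ∈ Set.Icc 0 T, uN t ∈ S N
  init : uN 0 = proj N u₀
  ode : ∀ t ∈ Set.Icc 0 T, HasDerivWithinAt uN (F N s (uN t)) (Set.Icc 0 T) t

/-- `Y 0, …, Y q` in `S N` are the stages of one step of size `k` of the composition, with
coefficients `b`, of the implicit midpoint rule; the result of the step is `Y q`. -/
structure IsStages (N : ℕ) (s k : ℝ) {q : ℕ} (b : Fin q → ℝ) (Y : Fin (q + 1) → Per) : Prop where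
  mem : ∀ j, Y j ∈ S N
  step : ∀ j : Fin q, Y j.succ =
    Y j.castSucc + (k * b j) • F N s ((1 / 2 : ℝ) • (Y j.succ + Y j.castSucc))

/-- `U⁰, …, U^M` together with the stages `Y^{n,0}, …, Y^{n,q}`, `0 ≤ n < M`, is a solution of the
fully discrete scheme with initial value `P_N u₀`. -/
structure IsFullyDiscrete (N : ℕ) (s k : ℝ) {q : ℕ} (b : Fin q → ℝ) {M : ℕ} (u₀ : Per)
    (U : Fin (M + 1) → Per) (Y : Fin M → Fin (q + 1) → Per) : Prop where
  init : U 0 = proj N u₀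
  start : ∀ n : Fin M, Y n 0 = U n.castSucc
  stages : ∀ n : Fin M, IsStages N s k b (Y n)
  next : ∀ n : Fin M, U n.succ = Y n (Fin.last q)

/-- The outer weight `1 / (2 - 2^{1/(2m+3)})` of the symmetric three-fold composition that raises the
order of a symmetric method from `2m + 2` to `2m + 4`; the middle weight is one minus twice it. -/
def yoshidaWeight (m : ℕ) : ℝ := 1 / (2 - (2 : ℝ) ^ (1 / (2 * (m : ℝ) + 3)))

/-- The coefficients `b_0, …, b_{q-1}`, `q = 3^m`, of Yoshida's method of order `2m + 2` based on the
implicit midpoint rule (`m = 0`): the three-fold composition is iterated `m` times. -/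
def yoshida : (m : ℕ) → Fin (3 ^ m) → ℝ
  | 0, _ => 1
  | m + 1, j =>
    (if (j : ℕ) / 3 ^ m = 1 then 1 - 2 * yoshidaWeight m else yoshidaWeight m) *
      yoshida m ⟨(j : ℕ) % 3 ^ m, Nat.mod_lt _ (by positivity)⟩

theorem yoshida_ne_zero (m : ℕ) (j : Fin (3 ^ m)) : yoshida m j ≠ 0 := by
  induction m with
  | zero => simp [yoshida]
  | succ m ih =>
    have h1 : (1 : ℝ) < (2 : ℝ) ^ (1 / (2 * (m : ℝ) + 3)) :=
      Real.one_lt_rpow (by norm_num) (by positivity)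
    have h2 : (2 : ℝ) ^ (1 / (2 * (m : ℝ) + 3)) < 2 := by
      have h : (1 : ℝ) / (2 * (m : ℝ) + 3) < 1 := by
        rw [div_lt_one (by positivity)]
        linarith [(Nat.cast_nonneg m : (0 : ℝ) ≤ m)]
      simpa using Real.rpow_lt_rpow_of_exponent_lt (by norm_num : (1 : ℝ) < 2) h
    have h3 : (0 : ℝ) < 2 - (2 : ℝ) ^ (1 / (2 * (m : ℝ) + 3)) := by linarith
    have h4 : (1 : ℝ) < yoshidaWeight m := by
      unfold yoshidaWeight
      rw [one_lt_div h3]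
      linarith
    rw [yoshida]
    refine mul_ne_zero ?_ (ih _)
    split_ifs
    · linarith
    · linarith

end FNLS

end

/-!
The scheme is compared with the semidiscrete solution `u^N`, and `u^N` with `P_N u`; all estimates
take place in `L²`, and `μ₀ = 2` suffices. `L²` carries the normalized measure here (`toL2`), with
its real inner product, and differs from `l2norm` by the factor `√(2π)` (`l2norm_eq`).

*Solvability.* With `W = (X + Y) / 2` one implicit midpoint step reads `W = X + K(W) W`, where
`K(W) x = (k b_j/2) (-i (-∂ₓₓ)^s x + i P_N(|W|² x))` is skew. The map `W ↦ (1 - K(W))⁻¹ X` preserves the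
ball of radius `ρ = ‖P_N u₀‖`, and by the inverse inequality `|v|_∞ ≤ √(2N+1) ‖v‖` on `S N` it is a
contraction there with constant `k |b_j| (2N+1) ρ² ≤ 3 R² k N |b_j| < 1`
(`existsUnique_eq_add_skew`, `existsUnique_midpoint`). Freezing the modulus instead of the whole
cubic term is what makes the stated step restriction sufficient.

*The key inequality.* In `⟨e, F(w + e) - F(w)⟩` the linear part and every real multiple of `e` drop
out, which leaves at most `(|w|_∞² + |w|_∞ |e|_∞) ‖e‖²` (`abs_inner_F_add_sub_le`). So a
perturbation `e` of a bounded `w` grows at a bounded rate as long as `|e|_∞` is bounded, and the inverse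
inequality deduces the latter from smallness of `√N ‖e‖`. No a priori bound on `|U^n|_∞` is needed.

*Space.* For `e = u^N - P_N u` this gives `‖e‖ = O(N^{-μ})` by a barrier argument
(`norm_toL2_semidiscrete_sub_proj_le`).

*Time.* If `u₀ ≠ 0` and `N` is large, `R` is bounded below, so that the step restriction bounds
`k N` and `√N k = O(√k)`. Since `F(P_N u(t_n))` is bounded in `L²`, the stages `Z` started from `u^N(t_n)`
stay within `O(k + N^{-μ})` of `P_N u(t_n)`, hence are bounded in the supremum norm
(`norm_stages_le`). The stages of the scheme differ from them by at most `2^q ‖U^n - u^N(t_n)‖` at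
first; if this is `O(k^α)`, the difference of the midpoints is small in the supremum norm too and
one step amplifies the error by at most `e^{σ}` with `σ = O(k)` (`norm_toL2_stages_last_sub_le`). The
discrete Gronwall inequality closes the induction (`norm_toL2_fullyDiscrete_sub_le`).

The remaining cases are trivial: for large `k` or small `N` conservation of mass and the bound on `u`
bound the error by a constant, and for `u₀ = 0` both `U^n` and `u^N` vanish.
-/

noncomputable section

namespace FNLS

open MeasureTheory AddCircle

/-! ### The `L²` inner product and Fourier coefficients on `S N` -/

/-- The embedding of continuous periodic functions into `L²` of the Haar probability measure. -/
def toL2 : Per →L[ℝ] Lp ℂ 2 (haarAddCircle (T := 2 * Real.pi)) :=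
  ContinuousMap.toLp 2 haarAddCircle ℝ

theorem toL2_injective : Function.Injective toL2 := ContinuousMap.toLp_injective _

theorem coeFn_toL2 (v : Per) : (toL2 v : AddCircle (2 * Real.pi) → ℂ) =ᵐ[haarAddCircle] v :=
  ContinuousMap.coeFn_toLp (p := 2) (𝕜 := ℝ) haarAddCircle v

theorem inner_toL2 (u v : Per) :
    inner ℝ (toL2 u) (toL2 v) = ∫ x, inner ℝ (u x) (v x) ∂haarAddCircle := by
  rw [L2.inner_def]
  refine integral_congr_ae ?_
  filter_upwards [coeFn_toL2 u, coeFn_toL2 v] with x hu hv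
  rw [hu, hv]

theorem integrable_of_continuous {E : Type*} [NormedAddCommGroup E]
    {f : AddCircle (2 * Real.pi) → E} (hf : Continuous f) : Integrable f haarAddCircle :=
  integrableOn_univ.mp (hf.continuousOn.integrableOn_compact isCompact_univ)

theorem norm_toL2_sq (v : Per) : ‖toL2 v‖ ^ 2 = ∫ x, ‖v x‖ ^ 2 ∂haarAddCircle := by
  rw [← real_inner_self_eq_norm_sq, inner_toL2]
  simp_rw [real_inner_self_eq_norm_sq]

theorem l2norm_eq (v : Per) : l2norm v = Real.sqrt (2 * Real.pi) * ‖toL2 v‖ := by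
  have h := AddCircle.intervalIntegral_preimage (2 * Real.pi) (-Real.pi) (fun x => ‖v x‖ ^ 2)
  rw [show -Real.pi + 2 * Real.pi = Real.pi by ring] at h
  have h2 := norm_toL2_sq v
  rw [integral_haarAddCircle, ← h, smul_eq_mul] at h2
  have hp := Real.two_pi_pos
  rw [l2norm, ← Real.sqrt_sq (norm_nonneg (toL2 v)), ← Real.sqrt_mul hp.le, h2,
    mul_inv_cancel_left₀ hp.ne']

theorem norm_toL2_le_mul {u v : Per} {c : ℝ} (hc : 0 ≤ c) (h : ∀ x, ‖u x‖ ≤ c * ‖v x‖) :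
    ‖toL2 u‖ ≤ c * ‖toL2 v‖ := by
  refine le_of_sq_le_sq ?_ (by positivity)
  rw [mul_pow, norm_toL2_sq, norm_toL2_sq, ← integral_const_mul]
  refine integral_mono (integrable_of_continuous (by fun_prop))
    (integrable_of_continuous (by fun_prop)) fun x => ?_
  rw [← mul_pow]
  exact pow_le_pow_left₀ (norm_nonneg _) (h x) 2

theorem norm_toL2_le_norm (v : Per) : ‖toL2 v‖ ≤ ‖v‖ := by
  have h := norm_toL2_le_mul (u := v) (v := (1 : Per)) (norm_nonneg v)
    (fun x => by simpa using v.norm_coe_le_norm x)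
  have h1 : ‖toL2 (1 : Per)‖ = 1 := by
    have := norm_toL2_sq (1 : Per)
    rw [← pow_left_inj₀ (norm_nonneg _) zero_le_one two_ne_zero]
    simpa using this
  simpa [h1] using h

theorem hasSum_sq_fourierCoeff_toL2 (v : Per) :
    HasSum (fun l : ℤ => ‖fourierCoeff v l‖ ^ 2) (‖toL2 v‖ ^ 2) := by
  have h := hasSum_sq_fourierCoeff (toL2 v)
  have e : ∀ l, fourierCoeff (toL2 v) l = fourierCoeff v l := fun l =>
    congrFun (fourierCoeff_congr_ae (coeFn_toL2 v)) l
  simp_rw [e] at h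
  convert h using 1
  rw [norm_toL2_sq]
  refine integral_congr_ae ?_
  filter_upwards [coeFn_toL2 v] with x hv
  rw [hv]

theorem fourierCoeff_add (u v : Per) (l : ℤ) :
    fourierCoeff (u + v : Per) l = fourierCoeff u l + fourierCoeff v l := by
  have := fourierCoeff.add (integrable_of_continuous u.continuous)
    (integrable_of_continuous v.continuous)
  exact congrFun this l

theorem fourierCoeff_smul (c : ℂ) (v : Per) (l : ℤ) :
    fourierCoeff (c • v : Per) l = c * fourierCoeff v l :=
  fourierCoeff.const_smul v c l

/-- The `l`-th Fourier coefficient as a linear map. -/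
def fourierCoeffₗ (l : ℤ) : Per →ₗ[ℂ] ℂ where
  toFun v := fourierCoeff v l
  map_add' u v := fourierCoeff_add u v l
  map_smul' c v := fourierCoeff_smul c v l

theorem fourierCoeff_sub (u v : Per) (l : ℤ) :
    fourierCoeff (u - v : Per) l = fourierCoeff u l - fourierCoeff v l :=
  map_sub (fourierCoeffₗ l) u v

theorem fourierCoeff_trigSum (N : ℕ) (c : ℤ → ℂ) (m : ℤ) :
    fourierCoeff (∑ l ∈ Finset.Icc (-(N : ℤ)) N, c l • (fourier l : Per) : Per) m =
      if m ∈ Finset.Icc (-(N : ℤ)) N then c m else 0 := by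
  have h := map_sum (fourierCoeffₗ m) (fun l => c l • (fourier l : Per))
    (Finset.Icc (-(N : ℤ)) N)
  have e : ∀ l, fourierCoeffₗ m (c l • (fourier l : Per)) = if m = l then c l else 0 := by
    intro l
    rw [map_smul]
    have : fourierCoeffₗ m (fourier l : Per) = (Pi.single l 1 : ℤ → ℂ) m :=
      congrFun (fourierCoeff_fourier (T := 2 * Real.pi) l) m
    rw [this]
    simp [Pi.single_apply]
  simp_rw [e] at h
  rw [Finset.sum_ite_eq] at h
  exact h

/-- Parseval's identity, tested against a single mode. -/
theorem inner_smul_fourier (c : ℂ) (l : ℤ) (g : Per) :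
    inner ℝ (toL2 (c • (fourier l : Per))) (toL2 g) = inner ℝ c (fourierCoeff g l) := by
  rw [inner_toL2, fourierCoeff]
  have : ∀ x, inner ℝ ((c • (fourier l : Per)) x) (g x) =
      Complex.reCLM (starRingEnd ℂ c * (fourier (-l) x • g x)) := by
    intro x
    rw [Complex.inner, fourier_neg]
    simp only [ContinuousMap.smul_apply, smul_eq_mul, map_mul, Complex.reCLM_apply]
    ring_nf
  simp_rw [this]
  rw [ContinuousLinearMap.integral_comp_comm _ (integrable_of_continuous (by fun_prop)),
    integral_const_mul, Complex.inner, mul_comm]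
  rfl

theorem inner_trigSum (N : ℕ) (c : ℤ → ℂ) (g : Per) :
    inner ℝ (toL2 (∑ l ∈ Finset.Icc (-(N : ℤ)) N, c l • (fourier l : Per))) (toL2 g) =
      ∑ l ∈ Finset.Icc (-(N : ℤ)) N, inner ℝ (c l) (fourierCoeff g l) := by
  rw [map_sum, sum_inner]
  exact Finset.sum_congr rfl fun l _ => inner_smul_fourier _ _ _

theorem trigSum_mem (N : ℕ) (c : ℤ → ℂ) :
    ∑ l ∈ Finset.Icc (-(N : ℤ)) N, c l • (fourier l : Per) ∈ S N := by
  refine Submodule.sum_mem _ fun l hl => Submodule.smul_mem _ _ (Submodule.subset_span ⟨l, ?_, rfl⟩)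
  rw [Finset.mem_Icc] at hl
  exact abs_le.mpr hl

theorem proj_mem (N : ℕ) (v : Per) : proj N v ∈ S N := trigSum_mem N _

theorem fracLap_mem (N : ℕ) (s : ℝ) (v : Per) : fracLap N s v ∈ S N := trigSum_mem N _

theorem smul_mem_S {N : ℕ} {v : Per} (r : ℝ) (hv : v ∈ S N) : r • v ∈ S N := by
  simpa using ((S N).restrictScalars ℝ).smul_mem r hv

theorem fourierCoeff_proj (N : ℕ) (v : Per) (m : ℤ) :
    fourierCoeff (proj N v) m =
      if m ∈ Finset.Icc (-(N : ℤ)) N then fourierCoeff v m else 0 :=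
  fourierCoeff_trigSum N (fun l => fourierCoeff v l) m

theorem fourierCoeff_fracLap (N : ℕ) (s : ℝ) (v : Per) (m : ℤ) :
    fourierCoeff (fracLap N s v) m = if m ∈ Finset.Icc (-(N : ℤ)) N then
      ((|(m : ℝ)| ^ (2 * s) : ℝ) : ℂ) * fourierCoeff v m else 0 :=
  fourierCoeff_trigSum N (fun l => ((|(l : ℝ)| ^ (2 * s) : ℝ) : ℂ) * fourierCoeff v l) m

/-- The projection `P_N` as a linear map. -/
def projₗ (N : ℕ) : Per →ₗ[ℂ] Per :=
  ∑ l ∈ Finset.Icc (-(N : ℤ)) N, (fourierCoeffₗ l).smulRight (fourier l : Per)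

theorem projₗ_apply (N : ℕ) (v : Per) : projₗ N v = proj N v := by
  simp [projₗ, proj, fourierCoeffₗ]

/-- The operator `(-∂ₓₓ)^s` on `S N` as a linear map. -/
def fracLapₗ (N : ℕ) (s : ℝ) : Per →ₗ[ℂ] Per :=
  ∑ l ∈ Finset.Icc (-(N : ℤ)) N,
    (((|(l : ℝ)| ^ (2 * s) : ℝ) : ℂ) • fourierCoeffₗ l).smulRight (fourier l : Per)

theorem fracLapₗ_apply (N : ℕ) (s : ℝ) (v : Per) : fracLapₗ N s v = fracLap N s v := by
  simp [fracLapₗ, fracLap, fourierCoeffₗ]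

theorem proj_sub (N : ℕ) (u v : Per) : proj N (u - v) = proj N u - proj N v := by
  simp_rw [← projₗ_apply, map_sub]

theorem proj_of_mem {N : ℕ} {v : Per} (hv : v ∈ S N) : proj N v = v := by
  rw [← projₗ_apply]
  have : S N ≤ LinearMap.eqLocus (projₗ N) LinearMap.id := by
    refine Submodule.span_le.mpr ?_
    rintro _ ⟨l, hl, rfl⟩
    change projₗ N (fourier l : Per) = fourier l
    rw [projₗ_apply, proj]
    have e : ∀ m, fourierCoeff (fourier l : Per) m = if m = l then (1 : ℂ) else 0 := by
      intro m
      rw [fourierCoeff_fourier, Pi.single_apply]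
    simp_rw [e, ite_smul, one_smul, zero_smul]
    rw [Finset.sum_ite_eq', if_pos (Finset.mem_Icc.mpr (abs_le.mp hl))]
  exact this hv

theorem inner_proj {N : ℕ} {v : Per} (hv : v ∈ S N) (g : Per) :
    inner ℝ (toL2 v) (toL2 (proj N g)) = inner ℝ (toL2 v) (toL2 g) := by
  rw [← proj_of_mem hv, proj, inner_trigSum, inner_trigSum]
  exact Finset.sum_congr rfl fun l hl => by rw [fourierCoeff_proj, if_pos hl]

/-- `P_N` is an orthogonal projection in `L²`, hence a contraction. -/
theorem norm_toL2_proj_le (N : ℕ) (g : Per) : ‖toL2 (proj N g)‖ ≤ ‖toL2 g‖ := by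
  have h := real_inner_le_norm (toL2 (proj N g)) (toL2 g)
  rw [← inner_proj (proj_mem N g), real_inner_self_eq_norm_sq] at h
  by_contra! hlt
  nlinarith [norm_nonneg (toL2 g)]

/-- `i (-∂ₓₓ)^s` is skew for the real inner product. -/
theorem inner_I_smul_fracLap {N : ℕ} {v : Per} (hv : v ∈ S N) (s : ℝ) :
    inner ℝ (toL2 v) (toL2 (Complex.I • fracLap N s v)) = 0 := by
  nth_rw 1 [← proj_of_mem hv]
  rw [proj, inner_trigSum]
  refine Finset.sum_eq_zero fun l hl => ?_
  rw [fourierCoeff_smul, fourierCoeff_fracLap, if_pos hl, Complex.inner]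
  simp
  ring

theorem norm_le_sum_fourierCoeff {N : ℕ} {v : Per} (hv : v ∈ S N) :
    ‖v‖ ≤ ∑ l ∈ Finset.Icc (-(N : ℤ)) N, ‖fourierCoeff v l‖ := by
  nth_rw 1 [← proj_of_mem hv]
  refine (norm_sum_le _ _).trans (Finset.sum_le_sum fun l _ => ?_)
  rw [norm_smul, fourier_norm, mul_one]

theorem norm_toL2_sq_of_mem {N : ℕ} {v : Per} (hv : v ∈ S N) :
    ‖toL2 v‖ ^ 2 = ∑ l ∈ Finset.Icc (-(N : ℤ)) N, ‖fourierCoeff v l‖ ^ 2 := by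
  refine (hasSum_sq_fourierCoeff_toL2 v).unique (hasSum_sum_of_ne_finset_zero fun l hl => ?_)
  rw [← proj_of_mem hv, fourierCoeff_proj, if_neg hl]
  simp

/-- The inverse inequality between the supremum norm and the `L²` norm on `S N`. -/
theorem norm_le_sqrt_mul_norm_toL2 {N : ℕ} {v : Per} (hv : v ∈ S N) :
    ‖v‖ ≤ Real.sqrt (2 * N + 1) * ‖toL2 v‖ := by
  refine (norm_le_sum_fourierCoeff hv).trans (le_of_sq_le_sq ?_ (by positivity))
  rw [mul_pow, Real.sq_sqrt (by positivity), norm_toL2_sq_of_mem hv]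
  refine (sq_sum_le_card_mul_sum_sq).trans (le_of_eq ?_)
  congr 1
  rw [Int.card_Icc, show ((N : ℤ) + 1 - -(N : ℤ)).toNat = 2 * N + 1 by omega]
  push_cast
  ring

/-! ### The vector field and the implicit midpoint equation -/

/-- The pointwise form of `abs_inner_cubic_sub_le`. The left side is `D Im(ē w)` up to sign, with
`D = |w + e|² - |w|² = 2 Re(ē w) + |e|²`. -/
theorem abs_inner_I_mul_cubic_sub_le (w e : ℂ) :
    |inner ℝ e (Complex.I * (((‖w + e‖ ^ 2 : ℝ) : ℂ) * (w + e) - ((‖w‖ ^ 2 : ℝ) : ℂ) * w))| ≤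
      (‖w‖ ^ 2 + ‖w‖ * ‖e‖) * ‖e‖ ^ 2 := by
  obtain ⟨a, b⟩ := w
  obtain ⟨c, d⟩ := e
  set W := ‖(⟨a, b⟩ : ℂ)‖ with hW
  set E := ‖(⟨c, d⟩ : ℂ)‖ with hE
  have hW2 : W ^ 2 = a ^ 2 + b ^ 2 := by
    rw [hW, ← Complex.normSq_eq_norm_sq, Complex.normSq_mk]; ring
  have hE2 : E ^ 2 = c ^ 2 + d ^ 2 := by
    rw [hE, ← Complex.normSq_eq_norm_sq, Complex.normSq_mk]; ring
  have hS2 : ‖(⟨a, b⟩ + ⟨c, d⟩ : ℂ)‖ ^ 2 = (a + c) ^ 2 + (b + d) ^ 2 := by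
    rw [← Complex.normSq_eq_norm_sq, Complex.normSq_apply]; simp; ring
  have hm : |c * b - d * a| ≤ W * E := by
    refine abs_le_of_sq_le_sq ?_ (by positivity)
    rw [mul_pow, hW2, hE2]
    nlinarith [sq_nonneg (a * c + b * d)]
  have key : inner ℝ (⟨c, d⟩ : ℂ) (Complex.I * (((‖(⟨a, b⟩ + ⟨c, d⟩ : ℂ)‖ ^ 2 : ℝ) : ℂ) *
      (⟨a, b⟩ + ⟨c, d⟩) - ((W ^ 2 : ℝ) : ℂ) * ⟨a, b⟩)) =
      -(2 * (a * c + b * d)) * (c * b - d * a) - E ^ 2 * (c * b - d * a) := by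
    rw [hS2, hW2, hE2, Complex.inner]
    simp only [Complex.mul_re, Complex.mul_im, Complex.sub_re, Complex.sub_im, Complex.add_re,
      Complex.add_im, Complex.I_re, Complex.I_im, Complex.ofReal_re, Complex.ofReal_im,
      Complex.conj_re, Complex.conj_im]
    ring
  rw [key]
  have h1 : |2 * (a * c + b * d) * (c * b - d * a)| ≤ W ^ 2 * E ^ 2 := by
    rw [hW2, hE2, abs_le]
    constructor
    · nlinarith [sq_nonneg (a * c + b * d + (c * b - d * a))]
    · nlinarith [sq_nonneg (a * c + b * d - (c * b - d * a))]
  have h2 := mul_le_mul_of_nonneg_left hm (sq_nonneg E)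
  rw [show -(2 * (a * c + b * d)) * (c * b - d * a) - E ^ 2 * (c * b - d * a) =
    -(2 * (a * c + b * d) * (c * b - d * a) + E ^ 2 * (c * b - d * a)) by ring, abs_neg]
  refine (abs_add_le _ _).trans ?_
  rw [abs_mul (E ^ 2), abs_of_nonneg (sq_nonneg E)]
  linarith

/-- The pairing of `e` with the increment of `i f`: the part of the increment of `f` that is a real
multiple of `e` drops out. An estimate by the Lipschitz constant of `f` would involve `|e|_∞²`. The
absolute value is needed since the coefficients `b_j` may be negative. -/
theorem abs_inner_cubic_sub_le (w e : Per) :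
    |inner ℝ (toL2 e) (toL2 (Complex.I • (cubic (w + e) - cubic w)))| ≤
      (‖w‖ ^ 2 + ‖w‖ * ‖e‖) * ‖toL2 e‖ ^ 2 := by
  rw [inner_toL2, norm_toL2_sq, ← integral_const_mul]
  refine (abs_integral_le_integral_abs).trans ?_
  refine integral_mono (integrable_of_continuous (by fun_prop))
    (integrable_of_continuous (by fun_prop)) fun x => ?_
  refine (abs_inner_I_mul_cubic_sub_le (w x) (e x)).trans ?_
  have h1 := w.norm_coe_le_norm x
  have h2 := e.norm_coe_le_norm x
  gcongr

/-- The function `|w|²`, complex-valued so that it acts on `Per` by multiplication. -/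
def absSq (w : Per) : Per where
  toFun x := ((‖w x‖ ^ 2 : ℝ) : ℂ)
  continuous_toFun := by fun_prop

theorem cubic_eq (w : Per) : cubic w = absSq w * w := rfl

theorem norm_toL2_absSq_sub_mul_le (u v w : Per) :
    ‖toL2 ((absSq u - absSq v) * w)‖ ≤ (‖u‖ + ‖v‖) * ‖w‖ * ‖toL2 (u - v)‖ := by
  refine norm_toL2_le_mul (by positivity) fun x => ?_
  have h1 : ‖(absSq u - absSq v) x‖ ≤ (‖u‖ + ‖v‖) * ‖(u - v) x‖ := by
    change ‖((‖u x‖ ^ 2 : ℝ) : ℂ) - ((‖v x‖ ^ 2 : ℝ) : ℂ)‖ ≤ _ * ‖u x - v x‖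
    rw [← Complex.ofReal_sub, Complex.norm_real, sq_sub_sq, norm_mul]
    gcongr
    · rw [Real.norm_of_nonneg (by positivity)]
      exact add_le_add (u.norm_coe_le_norm x) (v.norm_coe_le_norm x)
    · exact abs_norm_sub_norm_le _ _
  rw [ContinuousMap.mul_apply, norm_mul]
  calc _ ≤ (‖u‖ + ‖v‖) * ‖(u - v) x‖ * ‖w‖ :=
        mul_le_mul h1 (w.norm_coe_le_norm x) (norm_nonneg _) (by positivity)
    _ = _ := by ring

theorem norm_absSq_le (w : Per) : ‖absSq w‖ ≤ ‖w‖ ^ 2 := by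
  refine (ContinuousMap.norm_le _ (by positivity)).mpr fun x => ?_
  change ‖((‖w x‖ ^ 2 : ℝ) : ℂ)‖ ≤ _
  rw [Complex.norm_real, Real.norm_of_nonneg (by positivity)]
  exact pow_le_pow_left₀ (norm_nonneg _) (w.norm_coe_le_norm x) 2

theorem norm_toL2_mul_le (u v : Per) : ‖toL2 (u * v)‖ ≤ ‖u‖ * ‖toL2 v‖ := by
  refine norm_toL2_le_mul (norm_nonneg _) fun x => ?_
  rw [ContinuousMap.mul_apply, norm_mul]
  gcongr
  exact u.norm_coe_le_norm x

theorem norm_toL2_cubic_sub_le {u v : Per} {G : ℝ} (hu : ‖u‖ ≤ G) (hv : ‖v‖ ≤ G) :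
    ‖toL2 (cubic u - cubic v)‖ ≤ 3 * G ^ 2 * ‖toL2 (u - v)‖ := by
  have e : cubic u - cubic v = absSq u * (u - v) + (absSq u - absSq v) * v := by
    rw [cubic_eq, cubic_eq]; ring
  rw [e, map_add]
  refine (norm_add_le _ _).trans ?_
  have h1 := norm_toL2_mul_le (absSq u) (u - v)
  have h2 := norm_toL2_absSq_sub_mul_le u v v
  have h3 : ‖absSq u‖ ≤ G ^ 2 := (norm_absSq_le u).trans (by gcongr)
  have h4 : (‖u‖ + ‖v‖) * ‖v‖ ≤ (G + G) * G :=
    mul_le_mul (add_le_add hu hv) hv (norm_nonneg _) (by linarith [norm_nonneg u])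
  have h5 := mul_le_mul_of_nonneg_right h3 (norm_nonneg (toL2 (u - v)))
  have h6 := mul_le_mul_of_nonneg_right h4 (norm_nonneg (toL2 (u - v)))
  linarith

theorem norm_toL2_I_smul (v : Per) : ‖toL2 (Complex.I • v)‖ = ‖toL2 v‖ := by
  rw [← pow_left_inj₀ (norm_nonneg _) (norm_nonneg _) two_ne_zero, norm_toL2_sq, norm_toL2_sq]
  simp

theorem inner_I_smul_absSq_mul (w x : Per) :
    inner ℝ (toL2 x) (toL2 (Complex.I • (absSq w * x))) = 0 := by
  rw [inner_toL2]
  refine integral_eq_zero_of_ae (Filter.Eventually.of_forall fun t => ?_)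
  change inner ℝ (x t) (Complex.I * (((‖w t‖ ^ 2 : ℝ) : ℂ) * x t)) = 0
  rw [Complex.inner]
  rw [show Complex.I * (((‖w t‖ ^ 2 : ℝ) : ℂ) * x t) * (starRingEnd ℂ) (x t) =
    Complex.I * ((‖w t‖ ^ 2 : ℝ) : ℂ) * (x t * (starRingEnd ℂ) (x t)) by ring, Complex.mul_conj,
    mul_assoc, ← Complex.ofReal_mul, Complex.I_mul_re, Complex.ofReal_im, neg_zero]

theorem inner_I_smul_proj {N : ℕ} {v : Per} (hv : v ∈ S N) (g : Per) :
    inner ℝ (toL2 v) (toL2 (Complex.I • proj N g)) =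
      inner ℝ (toL2 v) (toL2 (Complex.I • g)) := by
  have : Complex.I • proj N g = proj N (Complex.I • g) := by
    simp_rw [← projₗ_apply, map_smul]
  rw [this, inner_proj hv]

/-- Conservation of mass: `F` is tangent to the spheres of `L²`. -/
theorem inner_F_self {N : ℕ} (s : ℝ) {v : Per} (hv : v ∈ S N) :
    inner ℝ (toL2 v) (toL2 (F N s v)) = 0 := by
  rw [F, map_add, map_neg, inner_add_right, inner_neg_right, inner_I_smul_fracLap hv,
    inner_I_smul_proj hv, cubic_eq, inner_I_smul_absSq_mul]
  simp

theorem F_add_sub {N : ℕ} (s : ℝ) (w e : Per) :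
    F N s (w + e) - F N s w = -(Complex.I • fracLap N s e) +
      Complex.I • proj N (cubic (w + e) - cubic w) := by
  simp only [F, ← fracLapₗ_apply, ← projₗ_apply, map_add, map_sub, smul_add, smul_sub]
  abel

theorem abs_inner_F_add_sub_le {N : ℕ} (s : ℝ) (w : Per) {e : Per} (he : e ∈ S N) :
    |inner ℝ (toL2 e) (toL2 (F N s (w + e) - F N s w))| ≤
      (‖w‖ ^ 2 + ‖w‖ * ‖e‖) * ‖toL2 e‖ ^ 2 := by
  rw [F_add_sub, map_add, map_neg, inner_add_right, inner_neg_right, inner_I_smul_fracLap he,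
    inner_I_smul_proj he, neg_zero, zero_add]
  exact abs_inner_cubic_sub_le w e

/-- A quasilinear equation `w = x₀ + K(w) w` with skew operators `K(w)` that depend on `w` in a
contractive way on the ball of radius `ρ` has exactly one solution if `‖x₀‖ ≤ ρ`. The solution is
the fixed point of `w ↦ (1 - K(w))⁻¹ x₀`, which maps that ball into itself since the `K(w)` are
skew. The norm is the one pulled back by `ι`. -/
theorem existsUnique_eq_add_skew {V H : Type*} [AddCommGroup V] [Module ℝ V]
    [FiniteDimensional ℝ V] [NormedAddCommGroup H] [InnerProductSpace ℝ H] (ι : V →ₗ[ℝ] H)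
    (hι : Function.Injective ι) (K : V → V →ₗ[ℝ] V) (hK : ∀ w x, inner ℝ (ι x) (ι (K w x)) = 0)
    {ρ κ : ℝ} (hκ0 : 0 ≤ κ) (hκ : κ < 1)
    (hlip : ∀ v w x, ‖ι v‖ ≤ ρ → ‖ι w‖ ≤ ρ → ‖ι x‖ ≤ ρ →
      ‖ι (K v x - K w x)‖ ≤ κ * ‖ι (v - w)‖) {x₀ : V} (hx₀ : ‖ι x₀‖ ≤ ρ) :
    ∃! w, w = x₀ + K w w := by
  have hbd : ∀ w y z, y - K w y = z → ‖ι y‖ ≤ ‖ι z‖ := by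
    intro w y z h
    have h1 := real_inner_le_norm (ι y) (ι z)
    rw [← h, map_sub, inner_sub_right, hK, sub_zero, real_inner_self_eq_norm_sq, ← map_sub, h] at h1
    by_contra! hlt
    nlinarith [norm_nonneg (ι z)]
  have hsurj : ∀ w, ∃ y, y - K w y = x₀ := by
    intro w
    have hinj : Function.Injective (LinearMap.id - K w : V →ₗ[ℝ] V) := by
      refine (injective_iff_map_eq_zero _).mpr fun y hy => hι ?_
      have := hbd w y 0 hy
      rw [map_zero, norm_zero] at this
      rw [map_zero]
      exact norm_le_zero_iff.mp this
    obtain ⟨y, hy⟩ := LinearMap.injective_iff_surjective.mp hinj x₀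
    exact ⟨y, hy⟩
  choose g hg using hsurj
  have hgρ : ∀ w, ‖ι (g w)‖ ≤ ρ := fun w => (hbd w _ _ (hg w)).trans hx₀
  have hgl : ∀ v w, ‖ι v‖ ≤ ρ → ‖ι w‖ ≤ ρ → ‖ι (g v - g w)‖ ≤ κ * ‖ι (v - w)‖ := by
    intro v w hv hw
    refine (hbd v _ (K v (g w) - K w (g w)) ?_).trans (hlip v w _ hv hw (hgρ w))
    have h1 := hg v
    have h2 := hg w
    rw [map_sub]
    rw [sub_eq_iff_eq_add] at h1 h2
    nth_rw 1 [h1, h2]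
    abel
  have hfix : ∀ w, w = x₀ + K w w ↔ g w = w := by
    intro w
    constructor
    · intro h
      have := hbd w (g w - w) 0 (by
        rw [map_sub, sub_sub_sub_comm, hg, sub_eq_zero]
        exact (sub_eq_of_eq_add h).symm)
      rw [map_zero, norm_zero] at this
      have := hι ((norm_le_zero_iff.mp this).trans (map_zero ι).symm)
      exact sub_eq_zero.mp this
    · intro h
      have := hg w
      rw [h] at this
      exact (sub_eq_iff_eq_add.mp this)
  simp_rw [hfix]
  let _ : NormedAddCommGroup V := NormedAddCommGroup.induced V H ι hι
  let _ : NormedSpace ℝ V := NormedSpace.induced ℝ V H ι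
  have _ : CompleteSpace V := FiniteDimensional.complete ℝ V
  have hball : ∀ w : V, w ∈ Metric.closedBall (0 : V) ρ ↔ ‖ι w‖ ≤ ρ := fun w =>
    (mem_closedBall_zero_iff : w ∈ _ ↔ ‖w‖ ≤ ρ)
  have hmaps : Set.MapsTo g (Metric.closedBall 0 ρ) (Metric.closedBall 0 ρ) := fun w _ =>
    (hball _).mpr (hgρ w)
  have hcontr : ContractingWith ⟨κ, hκ0⟩ (hmaps.restrict g _ _) := by
    refine ⟨hκ, LipschitzWith.of_dist_le_mul fun v w => ?_⟩
    rw [Subtype.dist_eq, Subtype.dist_eq, dist_eq_norm, dist_eq_norm]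
    exact hgl v w ((hball _).mp v.2) ((hball _).mp w.2)
  obtain ⟨w, hw, hgw, -⟩ := hcontr.exists_fixedPoint' Metric.isClosed_closedBall.isComplete hmaps
    ((hball _).mpr hx₀) (edist_ne_top _ _)
  refine ⟨w, hgw, fun v hv => hι ?_⟩
  have hvρ : ‖ι v‖ ≤ ρ := by
    have := hgρ v
    rwa [show g v = v from hv] at this
  have hwρ : ‖ι w‖ ≤ ρ := (hball _).mp hw
  have h := hgl v w hvρ hwρ
  rw [show g v = v from hv, show g w = w from hgw] at h
  have h0 : ‖ι (v - w)‖ ≤ 0 := by nlinarith [norm_nonneg (ι (v - w))]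
  rw [← sub_eq_zero, ← map_sub]
  exact norm_le_zero_iff.mp h0

instance finiteDimensional_S (N : ℕ) : FiniteDimensional ℂ (S N) := by
  have : {e : Per | ∃ l : ℤ, |l| ≤ (N : ℤ) ∧ e = fourier l} =
      (fun l : ℤ => (fourier l : Per)) '' (Set.Icc (-(N : ℤ)) N) := by
    ext e
    simp only [Set.mem_ofPred_eq, Set.mem_image, Set.mem_Icc, abs_le]
    exact ⟨fun ⟨l, h, e⟩ => ⟨l, h, e.symm⟩, fun ⟨l, h, e⟩ => ⟨l, h, e.symm⟩⟩
  exact FiniteDimensional.span_of_finite ℂ (this ▸ (Set.finite_Icc _ _).image _)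

/-- The linear part, frozen at `w`, of the implicit midpoint equation:
`x ↦ c (-i (-∂ₓₓ)^s x + i P_N(|w|² x))`. -/
def frozenF (N : ℕ) (s c : ℝ) (w : Per) : Per →ₗ[ℝ] Per :=
  c • ((-(Complex.I • fracLapₗ N s) + Complex.I •
    (projₗ N ∘ₗ LinearMap.mulLeft ℂ (absSq w))).restrictScalars ℝ)

theorem frozenF_apply (N : ℕ) (s c : ℝ) (w x : Per) : frozenF N s c w x =
    c • (-(Complex.I • fracLap N s x) + Complex.I • proj N (absSq w * x)) := by
  simp [frozenF, fracLapₗ_apply, projₗ_apply]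

theorem frozenF_mem (N : ℕ) (s c : ℝ) (w x : Per) : frozenF N s c w x ∈ S N := by
  rw [frozenF_apply]
  exact smul_mem_S _ (add_mem (neg_mem (Submodule.smul_mem _ _ (fracLap_mem N s x)))
    (Submodule.smul_mem _ _ (proj_mem N _)))

/-- Unique solvability of one implicit midpoint step. -/
theorem existsUnique_midpoint {N : ℕ} (s : ℝ) {k ρ : ℝ} (hk : |k| * (2 * N + 1) * ρ ^ 2 < 1)
    {X : Per} (hX : X ∈ S N) (hXρ : ‖toL2 X‖ ≤ ρ) :
    ∃! Y, Y ∈ S N ∧ Y = X + k • F N s ((1 / 2 : ℝ) • (Y + X)) := by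
  have hfd : FiniteDimensional ℝ ((S N).restrictScalars ℝ) :=
    FiniteDimensional.complexToReal (S N)
  let ι := toL2.toLinearMap ∘ₗ ((S N).restrictScalars ℝ).subtype
  let K : (S N).restrictScalars ℝ → (S N).restrictScalars ℝ →ₗ[ℝ] (S N).restrictScalars ℝ :=
    fun w => (frozenF N s (k / 2) w ∘ₗ ((S N).restrictScalars ℝ).subtype).codRestrict _
      fun x => frozenF_mem N s _ w x
  have hK : ∀ w x, ((K w x : (S N).restrictScalars ℝ) : Per) = (k / 2) •
      (-(Complex.I • fracLap N s x) + Complex.I • proj N (absSq w * x)) :=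
    fun w x => frozenF_apply _ _ _ _ _
  have hιK : ∀ x, ι x = toL2 x := fun _ => rfl
  have hρ : 0 ≤ ρ := (norm_nonneg _).trans hXρ
  obtain ⟨w, hw, huniq⟩ := existsUnique_eq_add_skew ι
    (toL2_injective.comp Subtype.val_injective) K (by
      intro w x
      rw [hιK, hιK, hK, map_smul, inner_smul_right, map_add, map_neg, inner_add_right,
        inner_neg_right, inner_I_smul_fracLap x.2, inner_I_smul_proj x.2, inner_I_smul_absSq_mul]
      simp) (by positivity) hk (ρ := ρ) (by
      intro v w x hv hw hx
      rw [hιK] at hv hw hx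
      rw [hιK, hιK]
      have e : ((K v x - K w x : (S N).restrictScalars ℝ) : Per) =
          (k / 2) • (Complex.I • proj N ((absSq v - absSq w) * x)) := by
        rw [Submodule.coe_sub, hK, hK, ← smul_sub, sub_mul, proj_sub, smul_sub]
        module
      rw [e, map_smul, norm_smul, norm_toL2_I_smul]
      have h1 := (norm_toL2_proj_le N _).trans
        (norm_toL2_absSq_sub_mul_le (v : Per) (w : Per) (x : Per))
      set c := Real.sqrt (2 * N + 1) with hc
      have hc2 : c ^ 2 = 2 * N + 1 := Real.sq_sqrt (by positivity)
      have hc0 : 0 ≤ c := Real.sqrt_nonneg _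
      have hv' : ‖(v : Per)‖ ≤ c * ρ := (norm_le_sqrt_mul_norm_toL2 v.2).trans (by gcongr)
      have hw' : ‖(w : Per)‖ ≤ c * ρ := (norm_le_sqrt_mul_norm_toL2 w.2).trans (by gcongr)
      have hx' : ‖(x : Per)‖ ≤ c * ρ := (norm_le_sqrt_mul_norm_toL2 x.2).trans (by gcongr)
      calc _ ≤ ‖k / 2‖ * ((c * ρ + c * ρ) * (c * ρ) * ‖toL2 ((v : Per) - w)‖) := by
            refine mul_le_mul_of_nonneg_left (h1.trans ?_) (norm_nonneg _)
            gcongr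
        _ = |k| * c ^ 2 * ρ ^ 2 * ‖toL2 ((v : Per) - w)‖ := by
            rw [norm_div, Real.norm_eq_abs, Real.norm_ofNat]; ring
        _ = _ := by rw [hc2]; rfl) (x₀ := ⟨X, hX⟩) hXρ
  have hKF : ∀ w : (S N).restrictScalars ℝ, ((K w w : (S N).restrictScalars ℝ) : Per) =
      (k / 2) • F N s w := fun w => hK w w
  have hwv : (w : Per) = X + (k / 2) • F N s w := by
    have := congrArg Subtype.val hw
    rwa [Submodule.coe_add, hKF] at this
  refine ⟨(2 : ℝ) • (w : Per) - X, ⟨sub_mem (smul_mem_S _ w.2) hX, ?_⟩, ?_⟩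
  · rw [sub_add_cancel, smul_smul, show (1 / 2 : ℝ) * 2 = 1 by norm_num, one_smul]
    nth_rw 1 [hwv]
    module
  · rintro Y ⟨hY, hYe⟩
    have hmem : (1 / 2 : ℝ) • (Y + X) ∈ (S N).restrictScalars ℝ := smul_mem_S _ (add_mem hY hX)
    have h := huniq ⟨(1 / 2 : ℝ) • (Y + X), hmem⟩ (by
      apply Subtype.ext
      rw [Submodule.coe_add, hKF]
      change (1 / 2 : ℝ) • (Y + X) = X + (k / 2) • F N s ((1 / 2 : ℝ) • (Y + X))
      nth_rw 1 [hYe]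
      module)
    rw [← h]
    module

/-! ### The fully discrete scheme: solvability, conservation of mass, one-step stability -/

/-- A recursion over `Fin (q + 1)` in which every step is uniquely solvable, as long as an invariant
`P` holds that the steps preserve, has a unique solution. -/
theorem existsUnique_fin_recursion {A : Type*} {q : ℕ} (P : A → Prop) (r : Fin q → A → A → Prop)
    (h : ∀ j x, P x → ∃! y, r j x y) (hP : ∀ j x y, P x → r j x y → P y) {a : A} (ha : P a) :
    ∃! Z : Fin (q + 1) → A, Z 0 = a ∧ ∀ j : Fin q, r j (Z j.castSucc) (Z j.succ) := by
  have key : ∀ Z : Fin (q + 1) → A, Z 0 = a → (∀ j : Fin q, r j (Z j.castSucc) (Z j.succ)) →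
      ∀ j, P (Z j) := by
    intro Z h0 hZ j
    induction j using Fin.induction with
    | zero => rwa [h0]
    | succ j ih => exact hP j _ _ ih (hZ j)
  have hex : ∀ (j : Fin q) (x : A), ∃ y, P x → r j x y := by
    intro j x
    by_cases hx : P x
    · obtain ⟨y, hy, -⟩ := h j x hx
      exact ⟨y, fun _ => hy⟩
    · exact ⟨x, fun hx' => absurd hx' hx⟩
  choose g hg using hex
  let Z : Fin (q + 1) → A := fun j => Fin.induction (motive := fun _ => A) a g j
  have hZP : ∀ j, P (Z j) := by
    intro j
    induction j using Fin.induction with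
    | zero => exact ha
    | succ j ih => exact hP j _ _ ih (hg j _ ih)
  refine ⟨Z, ⟨rfl, fun j => hg j _ (hZP _)⟩, ?_⟩
  rintro Z' ⟨h0, hZ'⟩
  funext j
  induction j using Fin.induction with
  | zero => exact h0
  | succ j ih =>
    refine (h j (Z j.castSucc) (hZP _)).unique ?_ (hg j _ (hZP _))
    have := hZ' j
    rwa [ih] at this

/-- The implicit midpoint rule conserves mass. -/
theorem norm_toL2_eq_of_step {N : ℕ} {s k : ℝ} {X Y : Per} (hX : X ∈ S N) (hY : Y ∈ S N)
    (h : Y = X + k • F N s ((1 / 2 : ℝ) • (Y + X))) : ‖toL2 Y‖ = ‖toL2 X‖ := by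
  have hmem : (1 / 2 : ℝ) • (Y + X) ∈ S N := smul_mem_S _ (add_mem hY hX)
  have h1 := inner_F_self s hmem
  have h2 : toL2 Y - toL2 X = k • toL2 (F N s ((1 / 2 : ℝ) • (Y + X))) := by
    rw [← map_sub, ← map_smul, sub_eq_of_eq_add' h]
  have h3 : inner ℝ (toL2 Y + toL2 X) (toL2 Y - toL2 X) = 0 := by
    rw [map_smul, inner_smul_left, map_add] at h1
    rw [h2, inner_smul_right]
    have : inner ℝ (toL2 Y + toL2 X) (toL2 (F N s ((1 / 2 : ℝ) • (Y + X)))) = 0 := by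
      simpa using h1
    rw [this, mul_zero]
  exact (real_inner_add_sub_eq_zero_iff _ _).mp h3

theorem norm_toL2_stages {N : ℕ} {s k : ℝ} {q : ℕ} {b : Fin q → ℝ} {Y : Fin (q + 1) → Per}
    (h : IsStages N s k b Y) (j : Fin (q + 1)) : ‖toL2 (Y j)‖ = ‖toL2 (Y 0)‖ := by
  induction j using Fin.induction with
  | zero => rfl
  | succ j ih => rw [← ih, norm_toL2_eq_of_step (h.mem _) (h.mem _) (h.step j)]

theorem norm_toL2_fullyDiscrete {N : ℕ} {s k : ℝ} {q : ℕ} {b : Fin q → ℝ} {M : ℕ} {u₀ : Per}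
    {U : Fin (M + 1) → Per} {Y : Fin M → Fin (q + 1) → Per}
    (h : IsFullyDiscrete N s k b u₀ U Y) (n : Fin (M + 1)) :
    ‖toL2 (U n)‖ = ‖toL2 (proj N u₀)‖ := by
  induction n using Fin.induction with
  | zero => rw [h.init]
  | succ n ih => rw [h.next, norm_toL2_stages (h.stages n), h.start, ih]

/-- Unique solvability of one step of the composition method. -/
theorem existsUnique_stages {N : ℕ} (s : ℝ) {k ρ : ℝ} {q : ℕ} {b : Fin q → ℝ}
    (hk : ∀ j, |k * b j| * (2 * N + 1) * ρ ^ 2 < 1) {X : Per} (hX : X ∈ S N)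
    (hXρ : ‖toL2 X‖ ≤ ρ) : ∃! Z, IsStages N s k b Z ∧ Z 0 = X := by
  have h := existsUnique_fin_recursion (q := q) (fun X : Per => X ∈ S N ∧ ‖toL2 X‖ ≤ ρ)
    (fun j X Y => Y ∈ S N ∧ Y = X + (k * b j) • F N s ((1 / 2 : ℝ) • (Y + X)))
    (fun j X hX => existsUnique_midpoint s (hk j) hX.1 hX.2)
    (fun j X Y hX hY => ⟨hY.1, (norm_toL2_eq_of_step hX.1 hY.1 hY.2).trans_le hX.2⟩) ⟨hX, hXρ⟩
  refine (existsUnique_congr fun Z => ⟨?_, ?_⟩).mp h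
  · rintro ⟨h0, hZ⟩
    refine ⟨⟨fun j => ?_, fun j => (hZ j).2⟩, h0⟩
    cases j using Fin.cases with
    | zero => rwa [h0]
    | succ j => exact (hZ j).1
  · rintro ⟨hZ, h0⟩
    exact ⟨h0, fun j => ⟨hZ.mem _, hZ.step j⟩⟩

/-- Unique solvability of the fully discrete scheme. -/
theorem existsUnique_fullyDiscrete {N : ℕ} (s : ℝ) {k ρ : ℝ} {q : ℕ} {b : Fin q → ℝ}
    (hk : ∀ j, |k * b j| * (2 * N + 1) * ρ ^ 2 < 1) (M : ℕ) {u₀ : Per}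
    (hρ : ‖toL2 (proj N u₀)‖ ≤ ρ) :
    ∃! W : (Fin (M + 1) → Per) × (Fin M → Fin (q + 1) → Per),
      IsFullyDiscrete N s k b u₀ W.1 W.2 := by
  have hst := fun (X : Per) (hX : X ∈ S N ∧ ‖toL2 X‖ ≤ ρ) =>
    existsUnique_stages s hk hX.1 hX.2
  have h := existsUnique_fin_recursion (q := M) (fun X : Per => X ∈ S N ∧ ‖toL2 X‖ ≤ ρ)
    (fun _ X Y => ∃ Z, (IsStages N s k b Z ∧ Z 0 = X) ∧ Y = Z (Fin.last q))
    (fun _ X hX => by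
      obtain ⟨Z, hZ, huniq⟩ := hst X hX
      refine ⟨Z (Fin.last q), ⟨Z, hZ, rfl⟩, ?_⟩
      rintro Y ⟨Z', hZ', rfl⟩
      rw [huniq Z' hZ'])
    (fun _ X Y hX hY => by
      obtain ⟨Z, hZ, rfl⟩ := hY
      refine ⟨hZ.1.mem _, ?_⟩
      rw [norm_toL2_stages hZ.1, hZ.2]
      exact hX.2) ⟨proj_mem N u₀, hρ⟩
  obtain ⟨U, ⟨hU0, hU⟩, huniq⟩ := h
  choose Y hY hYU using hU
  refine ⟨(U, Y), ⟨hU0, fun n => (hY n).2, fun n => (hY n).1, hYU⟩, ?_⟩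
  rintro ⟨U', Y'⟩ h'
  have hUU : U' = U := huniq U' ⟨h'.init, fun n => ⟨Y' n, ⟨h'.stages n, h'.start n⟩, h'.next n⟩⟩
  subst hUU
  refine Prod.ext rfl (funext fun n => ?_)
  refine (hst (U' n.castSucc) ⟨?_, ?_⟩).unique ⟨h'.stages n, h'.start n⟩ (hY n)
  · rw [← (hY n).2]
    exact (hY n).1.mem 0
  · rw [norm_toL2_fullyDiscrete h']
    exact hρ

/-- The energy inequality of one step, divided by `d + d₀` and solved for the new error `d`. -/
theorem le_of_sq_sub_sq_le {d d₀ ρ κ : ℝ} (hd : 0 ≤ d) (hd₀ : 0 ≤ d₀) (hρ : 0 ≤ ρ) (hκ : 0 ≤ κ)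
    (hκ3 : κ ≤ 1 / 3)
    (h : d ^ 2 - d₀ ^ 2 ≤ 2 * (2 * (κ * ((d + d₀) / 2) ^ 2)) + 2 * ((d + d₀) / 2 * ρ)) :
    d ≤ (1 + 3 * κ) * d₀ + 2 * ρ := by
  have hmain : (d - d₀) * (d + d₀) ≤ (κ * (d + d₀) + ρ) * (d + d₀) := by linarith
  rcases (add_nonneg hd hd₀).eq_or_lt with h0 | h0
  · have : d = 0 := by linarith
    rw [this]
    positivity
  · have h1 := le_of_mul_le_mul_right hmain h0
    -- `(1 + κ) / (1 - κ) ≤ 1 + 3 κ` and `1 / (1 - κ) ≤ 2` for `0 ≤ κ ≤ 1/3`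
    have h2 : (1 - κ) * d ≤ (1 + κ) * d₀ + ρ := by linarith
    have h3 : (1 + κ) * d₀ + ρ ≤ (1 - κ) * ((1 + 3 * κ) * d₀ + 2 * ρ) := by
      have h4 : 0 ≤ κ * (1 - 3 * κ) * d₀ :=
        mul_nonneg (mul_nonneg hκ (by linarith)) hd₀
      have h5 : 0 ≤ (1 - 2 * κ) * ρ := mul_nonneg (by linarith) hρ
      linarith
    exact le_of_mul_le_mul_left (h2.trans h3) (by linarith)

/-- Comparison of one implicit midpoint step with a step perturbed by a residual `r`. -/
theorem norm_toL2_step_sub_le {N : ℕ} {s k G E κ : ℝ} {X Y X' Y' r : Per}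
    (hX : X ∈ S N) (hY : Y ∈ S N) (hX' : X' ∈ S N) (hY' : Y' ∈ S N)
    (h : Y = X + k • F N s ((1 / 2 : ℝ) • (Y + X)))
    (h' : Y' = X' + k • F N s ((1 / 2 : ℝ) • (Y' + X')) - r)
    (hG : ‖(1 / 2 : ℝ) • (Y' + X')‖ ≤ G)
    (hE : ‖(1 / 2 : ℝ) • ((Y - Y') + (X - X'))‖ ≤ E)
    (hκ : |k| * (G ^ 2 + G * E) / 2 ≤ κ) (hκ3 : κ ≤ 1 / 3) :
    ‖toL2 (Y - Y')‖ ≤ (1 + 3 * κ) * ‖toL2 (X - X')‖ + 2 * ‖toL2 r‖ := by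
  set w := (1 / 2 : ℝ) • (Y' + X') with hw
  set ε := (1 / 2 : ℝ) • ((Y - Y') + (X - X')) with hε
  have hεS : ε ∈ S N := smul_mem_S _ (add_mem (sub_mem hY hY') (sub_mem hX hX'))
  have hwε : (1 / 2 : ℝ) • (Y + X) = w + ε := by rw [hw, hε]; module
  have hdiff : (Y - Y') - (X - X') = k • (F N s (w + ε) - F N s w) + r := by
    rw [hwε] at h
    nth_rw 1 [h, h']
    module
  set d := ‖toL2 (Y - Y')‖ with hd
  set d₀ := ‖toL2 (X - X')‖ with hd₀
  set ρ := ‖toL2 r‖ with hρ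
  have hd0 : 0 ≤ d := norm_nonneg _
  have hd₀0 : 0 ≤ d₀ := norm_nonneg _
  have hρ0 : 0 ≤ ρ := norm_nonneg _
  have hG0 : 0 ≤ G := (norm_nonneg _).trans hG
  have hE0 : 0 ≤ E := (norm_nonneg _).trans hE
  have hκ0 : 0 ≤ κ := le_trans (by positivity) hκ
  have hεn : ‖toL2 ε‖ ≤ (d + d₀) / 2 := by
    rw [hε, map_smul, map_add, norm_smul, Real.norm_of_nonneg (by norm_num)]
    linarith [norm_add_le (toL2 (Y - Y')) (toL2 (X - X'))]
  -- the energy identity `d² - d₀² = 2 ⟨ε, (Y - Y') - (X - X')⟩`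
  have hen : d ^ 2 - d₀ ^ 2 = 2 * inner ℝ (toL2 ε) (toL2 ((Y - Y') - (X - X'))) := by
    rw [hε, map_smul, map_add, map_sub toL2 (Y - Y'), inner_smul_left, inner_add_left,
      inner_sub_right, inner_sub_right, real_inner_self_eq_norm_sq, real_inner_self_eq_norm_sq,
      real_inner_comm (toL2 (Y - Y')) (toL2 (X - X'))]
    simp [hd, hd₀, map_sub]
  have hF : k * inner ℝ (toL2 ε) (toL2 (F N s (w + ε) - F N s w)) ≤
      2 * κ * ‖toL2 ε‖ ^ 2 := by
    refine (le_abs_self _).trans ?_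
    rw [abs_mul]
    calc _ ≤ |k| * ((‖w‖ ^ 2 + ‖w‖ * ‖ε‖) * ‖toL2 ε‖ ^ 2) := by
          gcongr
          exact abs_inner_F_add_sub_le s w hεS
      _ ≤ |k| * ((G ^ 2 + G * E) * ‖toL2 ε‖ ^ 2) := by gcongr
      _ ≤ _ := by nlinarith [sq_nonneg ‖toL2 ε‖]
  have hr : inner ℝ (toL2 ε) (toL2 r) ≤ ‖toL2 ε‖ * ρ := real_inner_le_norm _ _
  rw [hdiff, map_add, map_smul toL2 k, inner_add_right, inner_smul_right] at hen
  refine le_of_sq_sub_sq_le hd0 hd₀0 hρ0 hκ0 hκ3 ?_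
  have h1 := mul_le_mul_of_nonneg_left (pow_le_pow_left₀ (norm_nonneg _) hεn 2) hκ0
  have h2 := mul_le_mul_of_nonneg_right hεn hρ0
  linarith

/-! ### Sobolev bounds and the semidiscrete error -/

theorem sobolevNorm_sq (μ : ℝ) (v : Per) :
    sobolevNorm μ v ^ 2 = ∑' l : ℤ, (1 + (l : ℝ) ^ 2) ^ μ * ‖fourierCoeff v l‖ ^ 2 :=
  Real.sq_sqrt (tsum_nonneg fun l => by positivity)

/-- A Fourier multiplier bounded by `c (1 + l²)^{μ/2}` maps `H^μ` to `L²`. -/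
theorem norm_toL2_le_mul_sobolevNorm {μ c : ℝ} {v w : Per} (hc : 0 ≤ c) (hv : MemSobolev μ v)
    (h : ∀ l : ℤ, ‖fourierCoeff w l‖ ^ 2 ≤
      c ^ 2 * ((1 + (l : ℝ) ^ 2) ^ μ * ‖fourierCoeff v l‖ ^ 2)) :
    ‖toL2 w‖ ≤ c * sobolevNorm μ v := by
  refine le_of_sq_le_sq ?_ (mul_nonneg hc (Real.sqrt_nonneg _))
  rw [mul_pow, sobolevNorm_sq]
  exact hasSum_le h (hasSum_sq_fourierCoeff_toL2 w) (hv.hasSum.mul_left _)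

theorem norm_toL2_le_sobolevNorm {μ : ℝ} (hμ : 0 ≤ μ) {v : Per} (hv : MemSobolev μ v) :
    ‖toL2 v‖ ≤ sobolevNorm μ v := by
  rw [← one_mul (sobolevNorm μ v)]
  refine norm_toL2_le_mul_sobolevNorm zero_le_one hv fun l => ?_
  rw [one_pow, one_mul]
  refine le_mul_of_one_le_left (by positivity) (Real.one_le_rpow ?_ hμ)
  linarith [sq_nonneg (l : ℝ)]

/-- The spectral truncation error. -/
theorem norm_toL2_sub_proj_le {μ : ℝ} (hμ : 0 ≤ μ) {v : Per} (hv : MemSobolev μ v) {N : ℕ}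
    (hN : 1 ≤ N) : ‖toL2 (v - proj N v)‖ ≤ (N : ℝ) ^ (-μ) * sobolevNorm μ v := by
  have hN0 : (0 : ℝ) < N := by exact_mod_cast hN
  refine norm_toL2_le_mul_sobolevNorm (by positivity) hv fun l => ?_
  rw [fourierCoeff_sub, fourierCoeff_proj]
  split_ifs with hl
  · rw [sub_self, norm_zero, zero_pow two_ne_zero]
    positivity
  · rw [sub_zero, ← mul_assoc]
    refine le_mul_of_one_le_left (by positivity) ?_
    have h1 : (N : ℝ) ^ 2 ≤ 1 + (l : ℝ) ^ 2 := by
      have : (N : ℤ) ≤ |l| := by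
        by_contra! hlt
        exact hl (Finset.mem_Icc.mpr (abs_le.mp hlt.le))
      have h2 : (N : ℝ) ≤ |(l : ℝ)| := by exact_mod_cast this
      have h3 := pow_le_pow_left₀ hN0.le h2 2
      rw [sq_abs] at h3
      linarith
    calc (1 : ℝ) = ((N : ℝ) ^ (-μ)) ^ 2 * ((N : ℝ) ^ 2) ^ μ := by
          rw [← Real.rpow_natCast, ← Real.rpow_natCast, ← Real.rpow_mul hN0.le,
            ← Real.rpow_mul hN0.le, ← Real.rpow_add hN0]
          push_cast
          rw [show -μ * 2 + 2 * μ = 0 by ring, Real.rpow_zero]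
      _ ≤ _ := by gcongr

theorem norm_toL2_fracLap_le {μ s : ℝ} (hs : 0 ≤ s) (hμ : 2 * s ≤ μ) {v : Per}
    (hv : MemSobolev μ v) (N : ℕ) : ‖toL2 (fracLap N s v)‖ ≤ sobolevNorm μ v := by
  rw [← one_mul (sobolevNorm μ v)]
  refine norm_toL2_le_mul_sobolevNorm zero_le_one hv fun l => ?_
  rw [fourierCoeff_fracLap, one_pow, one_mul]
  split_ifs with hl
  · rw [norm_mul, mul_pow]
    gcongr
    have h1 : (1 : ℝ) ≤ 1 + (l : ℝ) ^ 2 := by linarith [sq_nonneg (l : ℝ)]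
    rw [Complex.norm_real, Real.norm_of_nonneg (by positivity), ← Real.rpow_natCast,
      ← Real.rpow_mul (abs_nonneg _)]
    calc |(l : ℝ)| ^ (2 * s * (2 : ℕ)) = (|(l : ℝ)| ^ 2) ^ (2 * s) := by
          rw [← Real.rpow_natCast, ← Real.rpow_mul (abs_nonneg _)]
          ring_nf
      _ ≤ (1 + (l : ℝ) ^ 2) ^ (2 * s) := by
          rw [sq_abs]
          gcongr
          linarith
      _ ≤ _ := Real.rpow_le_rpow_of_exponent_le h1 hμ
  · rw [norm_zero, zero_pow two_ne_zero]
    positivity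

theorem summable_inv_one_add_sq : Summable fun l : ℤ => (1 + (l : ℝ) ^ 2)⁻¹ := by
  refine Summable.of_norm_bounded_eventually (Real.summable_one_div_int_pow.mpr one_lt_two) ?_
  filter_upwards [(Set.finite_singleton (0 : ℤ)).compl_mem_cofinite] with l hl
  have hl0 : (l : ℝ) ≠ 0 := by exact_mod_cast hl
  rw [Real.norm_of_nonneg (by positivity), one_div]
  gcongr
  linarith

/-- A bound for `∑ |v̂(l)|`, and so for `|v|_∞` and `|P_N v|_∞`, if `‖v‖_μ ≤ B` for some `μ ≥ 1`.
It is quadratic in `B` because it comes from the inequality between the means instead of Cauchy-Schwarz;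
only its independence of `N` matters. -/
def sobolevSupBound (B : ℝ) : ℝ := (∑' l : ℤ, (1 + (l : ℝ) ^ 2)⁻¹ + B ^ 2) / 2

theorem summable_fourierCoeff_and_tsum_le {μ B : ℝ} (hμ : 1 ≤ μ) {v : Per} (hv : MemSobolev μ v)
    (hB : sobolevNorm μ v ≤ B) : Summable (fun l : ℤ => ‖fourierCoeff v l‖) ∧
      ∑' l : ℤ, ‖fourierCoeff v l‖ ≤ sobolevSupBound B := by
  have hs := (summable_inv_one_add_sq.hasSum.add hv.hasSum).div_const 2
  -- `2 |v̂(l)| ≤ (1 + l²)⁻¹ + (1 + l²) |v̂(l)|²`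
  have hle : ∀ l : ℤ, ‖fourierCoeff v l‖ ≤ ((1 + (l : ℝ) ^ 2)⁻¹ +
      (1 + (l : ℝ) ^ 2) ^ μ * ‖fourierCoeff v l‖ ^ 2) / 2 := by
    intro l
    have h1 : (1 : ℝ) ≤ 1 + (l : ℝ) ^ 2 := by linarith [sq_nonneg (l : ℝ)]
    have h2 : 1 + (l : ℝ) ^ 2 ≤ (1 + (l : ℝ) ^ 2) ^ μ := Real.self_le_rpow_of_one_le h1 hμ
    set x := 1 + (l : ℝ) ^ 2
    set c := ‖fourierCoeff v l‖
    have h3 : 2 * c ≤ x⁻¹ + x * c ^ 2 := by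
      have h4 : 0 ≤ x⁻¹ * (x * c - 1) ^ 2 := by positivity
      have h5 : x⁻¹ * (x * c - 1) ^ 2 = x⁻¹ + x * c ^ 2 - 2 * c := by
        have : x ≠ 0 := by positivity
        field_simp
        ring
      linarith
    have h6 : x * c ^ 2 ≤ x ^ μ * c ^ 2 := by gcongr
    linarith
  have hsum := Summable.of_nonneg_of_le (fun l => norm_nonneg _) hle hs.summable
  refine ⟨hsum, (hasSum_le hle hsum.hasSum hs).trans ?_⟩
  rw [← sobolevNorm_sq, sobolevSupBound]
  have : 0 ≤ sobolevNorm μ v := Real.sqrt_nonneg _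
  gcongr

theorem norm_le_sobolevSupBound {μ B : ℝ} (hμ : 1 ≤ μ) {v : Per} (hv : MemSobolev μ v)
    (hB : sobolevNorm μ v ≤ B) : ‖v‖ ≤ sobolevSupBound B := by
  obtain ⟨hs, hle⟩ := summable_fourierCoeff_and_tsum_le hμ hv hB
  rw [← (hasSum_fourier_series_of_summable hs.of_norm).tsum_eq]
  have e : ∀ l, ‖fourierCoeff v l • (fourier l : Per)‖ = ‖fourierCoeff v l‖ := fun l => by
    rw [norm_smul, fourier_norm, mul_one]
  refine (norm_tsum_le_tsum_norm (by simpa only [e] using hs)).trans ?_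
  simpa only [e] using hle

theorem norm_proj_le_sobolevSupBound {μ B : ℝ} (hμ : 1 ≤ μ) {v : Per} (hv : MemSobolev μ v)
    (hB : sobolevNorm μ v ≤ B) (N : ℕ) : ‖proj N v‖ ≤ sobolevSupBound B := by
  obtain ⟨hs, hle⟩ := summable_fourierCoeff_and_tsum_le hμ hv hB
  refine (norm_sum_le _ _).trans (le_trans ?_ hle)
  have e : ∀ l, ‖fourierCoeff v l • (fourier l : Per)‖ = ‖fourierCoeff v l‖ := fun l => by
    rw [norm_smul, fourier_norm, mul_one]
  simp_rw [e]
  exact hs.sum_le_tsum _ fun _ _ => norm_nonneg _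

theorem fracLap_proj (N : ℕ) (s : ℝ) (v : Per) : fracLap N s (proj N v) = fracLap N s v :=
  Finset.sum_congr rfl fun l hl => by rw [fourierCoeff_proj, if_pos hl]

/-- Consistency in space: `F(P_N v)` is bounded in `L²` uniformly in `N` for `v` in `H^μ`. -/
theorem norm_toL2_F_proj_le {μ s B : ℝ} (hs : 0 ≤ s) (hμs : 2 * s ≤ μ) (hμ : 1 ≤ μ) {v : Per}
    (hv : MemSobolev μ v) (hB : sobolevNorm μ v ≤ B) (N : ℕ) :
    ‖toL2 (F N s (proj N v))‖ ≤ B + sobolevSupBound B ^ 2 * B := by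
  have h1 := (norm_toL2_fracLap_le hs hμs hv N).trans hB
  have h2 := norm_toL2_proj_le N (cubic (proj N v))
  have h3 := norm_toL2_mul_le (absSq (proj N v)) (proj N v)
  have h4 := norm_proj_le_sobolevSupBound hμ hv hB N
  have h5 := (norm_toL2_proj_le N v).trans ((norm_toL2_le_sobolevNorm (by linarith) hv).trans hB)
  have h6 : ‖absSq (proj N v)‖ ≤ sobolevSupBound B ^ 2 := (norm_absSq_le _).trans (by gcongr)
  rw [F, fracLap_proj, map_add, map_neg]
  refine (norm_add_le _ _).trans ?_
  rw [norm_neg, norm_toL2_I_smul, norm_toL2_I_smul]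
  refine add_le_add h1 (h2.trans (h3.trans ?_))
  gcongr

/-- Conservation of mass for the semidiscrete solution. -/
theorem norm_toL2_semidiscrete {N : ℕ} {s T : ℝ} {u₀ : Per} {uN : ℝ → Per}
    (h : IsSemidiscrete N s T u₀ uN) {t : ℝ} (ht : t ∈ Set.Icc 0 T) :
    ‖toL2 (uN t)‖ = ‖toL2 (proj N u₀)‖ := by
  have hT : 0 ≤ T := ht.1.trans ht.2
  have hd : ∀ t ∈ Set.Icc 0 T,
      HasDerivWithinAt (fun t => ‖toL2 (uN t)‖ ^ 2) 0 (Set.Icc 0 T) t := by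
    intro t ht
    have h1 := (toL2.hasFDerivAt.comp_hasDerivWithinAt t (h.ode t ht)).norm_sq
    simp only [Function.comp_apply] at h1
    rwa [inner_F_self s (h.mem t ht), mul_zero] at h1
  rcases hT.eq_or_lt with hT0 | hT0
  · have : t = 0 := le_antisymm (hT0 ▸ ht.2) ht.1
    rw [this, h.init]
  have h2 := constant_of_derivWithin_zero (fun t ht => (hd t ht).differentiableWithinAt)
    (fun t ht => (hd t (Set.Ico_subset_Icc_self ht)).derivWithin
      (uniqueDiffOn_Icc hT0 t (Set.Ico_subset_Icc_self ht))) t ht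
  rw [h.init] at h2
  exact (pow_left_inj₀ (norm_nonneg _) (norm_nonneg _) two_ne_zero).mp h2

/-- `P_N u` solves the semidiscrete equation up to the residual `i P_N (f(u) - f(P_N u))`. -/
theorem hasDerivWithinAt_proj {N : ℕ} {s T : ℝ} {u₀ : Per} {u : ℝ → Per}
    (h : IsSolution s T u₀ u) {t : ℝ} (ht : t ∈ Set.Icc 0 T) :
    HasDerivWithinAt (fun τ => proj N (u τ)) (F N s (proj N (u t)) +
      Complex.I • proj N (cubic (u t) - cubic (proj N (u t)))) (Set.Icc 0 T) t := by
  have h1 := HasDerivWithinAt.fun_sum (u := Finset.Icc (-(N : ℤ)) N) fun l _ =>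
    (h.eqn t ht l).smul_const (fourier l : Per)
  refine h1.congr_deriv ?_
  rw [F, fracLap_proj, proj_sub]
  simp only [fracLap, proj, smul_sub, Finset.smul_sum, ← Finset.sum_neg_distrib]
  rw [add_assoc, add_sub_cancel, ← Finset.sum_add_distrib]
  refine Finset.sum_congr rfl fun l _ => ?_
  module

/-- Error of the semidiscretization, with `A` in the role of `N^{-μ}`. The error `e = u^N - P_N u`
satisfies `e' = F(P_N u + e) - F(P_N u) - i P_N (f(u) - f(P_N u))`, so that `‖e‖²` stays below the
barrier `((Q + 1) A)² exp(L t)`: where it touches the barrier, the inverse inequality gives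
`|e|_∞ ≤ 1`, and its derivative is smaller than that of the barrier. -/
theorem norm_toL2_semidiscrete_sub_proj_le {N : ℕ} {s T G Q L A : ℝ} {u₀ : Per} {u uN : ℝ → Per}
    (h : IsSolution s T u₀ u) (hN : IsSemidiscrete N s T u₀ uN) (hT : 0 ≤ T) (hA : 0 < A)
    (hG : ∀ t ∈ Set.Icc 0 T, ‖proj N (u t)‖ ≤ G) (hQ0 : 0 ≤ Q)
    (hQ : ∀ t ∈ Set.Icc 0 T, ‖toL2 (cubic (u t) - cubic (proj N (u t)))‖ ≤ Q * A)
    (hL : L = 2 * (G ^ 2 + G) + 2)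
    (hsmall : Real.sqrt (2 * N + 1) * ((Q + 1) * A * Real.exp (L * T / 2)) ≤ 1)
    {t : ℝ} (ht : t ∈ Set.Icc 0 T) :
    ‖toL2 (uN t - proj N (u t))‖ ≤ (Q + 1) * A * Real.exp (L * T / 2) := by
  have hG0 : 0 ≤ G := (norm_nonneg _).trans (hG 0 ⟨le_rfl, hT⟩)
  have hL0 : 0 ≤ L := by rw [hL]; positivity
  set w : ℝ → Per := fun t => proj N (u t) with hw
  set e : ℝ → Per := fun t => uN t - w t with he
  have hder : ∀ t ∈ Set.Icc 0 T, HasDerivWithinAt (fun t => ‖toL2 (e t)‖ ^ 2)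
      (2 * inner ℝ (toL2 (e t)) (toL2 (F N s (uN t) - (F N s (w t) +
        Complex.I • proj N (cubic (u t) - cubic (w t)))))) (Set.Icc 0 T) t := fun t ht =>
    (toL2.hasFDerivAt.comp_hasDerivWithinAt t
      ((hN.ode t ht).sub (hasDerivWithinAt_proj h ht))).norm_sq
  have hexp : ∀ t, HasDerivAt (fun t => ((Q + 1) * A) ^ 2 * Real.exp (L * t))
      (L * (((Q + 1) * A) ^ 2 * Real.exp (L * t))) t := by
    intro t
    have h1 : HasDerivAt (fun t => ((Q + 1) * A) ^ 2 * Real.exp (L * t))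
        (((Q + 1) * A) ^ 2 * (Real.exp (L * t) * (L * 1))) t :=
      ((hasDerivAt_id t).const_mul L).exp.const_mul _
    exact h1.congr_deriv (by ring)
  have hsq : ∀ t ∈ Set.Icc 0 T, ((Q + 1) * A) ^ 2 * Real.exp (L * t) ≤
      ((Q + 1) * A * Real.exp (L * T / 2)) ^ 2 := by
    intro t ht
    rw [mul_pow _ (Real.exp _), ← Real.exp_nat_mul]
    have : L * t ≤ (2 : ℕ) * (L * T / 2) := by
      push_cast
      nlinarith [ht.2]
    gcongr
  have hfence := image_le_of_deriv_right_lt_deriv_boundary'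
    (fun t ht => (hder t ht).continuousWithinAt)
    (fun t ht => (hder t (Set.Ico_subset_Icc_self ht)).mono_of_mem_nhdsWithin
      (Icc_mem_nhdsGE_of_mem ht))
    (B := fun t => ((Q + 1) * A) ^ 2 * Real.exp (L * t)) (by
      have : e 0 = 0 := by
        simp only [he, hw]
        rw [hN.init, h.init, sub_self]
      rw [this, map_zero, norm_zero, zero_pow two_ne_zero]
      positivity)
    (fun t _ => (hexp t).continuousAt.continuousWithinAt)
    (fun t _ => (hexp t).hasDerivWithinAt) (by
      intro t ht htB
      have ht' := Set.Ico_subset_Icc_self ht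
      have heS : e t ∈ S N := sub_mem (hN.mem t ht') (proj_mem N _)
      set δ := ‖toL2 (e t)‖ with hδ
      have hδ0 : 0 ≤ δ := norm_nonneg _
      have hδ1 : δ ≤ (Q + 1) * A * Real.exp (L * T / 2) :=
        le_of_sq_le_sq (htB.trans_le (hsq t ht')) (by positivity)
      have hinf : ‖e t‖ ≤ 1 := (norm_le_sqrt_mul_norm_toL2 heS).trans
        (le_trans (by gcongr) hsmall)
      have hlow : ((Q + 1) * A) ^ 2 ≤ δ ^ 2 := by
        rw [htB]
        exact le_mul_of_one_le_right (by positivity)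
          (Real.one_le_exp (mul_nonneg hL0 ht.1))
      have h1 := (abs_le.mp (abs_inner_F_add_sub_le s (w t) heS)).2
      have h2 : (‖w t‖ ^ 2 + ‖w t‖ * ‖e t‖) * δ ^ 2 ≤ (G ^ 2 + G * 1) * δ ^ 2 := by
        have := hG t ht'
        gcongr
      have h3 := (real_inner_le_norm (toL2 (e t)) (-toL2 (Complex.I •
        proj N (cubic (u t) - cubic (w t)))))
      rw [norm_neg, norm_toL2_I_smul, inner_neg_right] at h3
      have h4 : ‖toL2 (proj N (cubic (u t) - cubic (w t)))‖ ≤ Q * A :=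
        (norm_toL2_proj_le N _).trans (hQ t ht')
      have h5 := mul_le_mul_of_nonneg_left h4 hδ0
      rw [← htB, ← sub_sub, map_sub toL2 (F N s (uN t) - F N s (w t)), inner_sub_right,
        show uN t = w t + e t by simp [he]]
      have h6 : (Q * A) ^ 2 < ((Q + 1) * A) ^ 2 := by
        have : Q * A < (Q + 1) * A := by nlinarith
        gcongr
      rw [hL]
      nlinarith [sq_nonneg (δ - Q * A)])
  exact le_of_sq_le_sq ((hfence ht).trans (hsq t ht)) (by positivity)

/-! ### Error propagation for the composition method -/

theorem norm_half_smul_add_le {N : ℕ} {X Y : Per} {a : ℝ} (hX : X ∈ S N) (hY : Y ∈ S N)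
    (hXa : ‖toL2 X‖ ≤ a) (hYa : ‖toL2 Y‖ ≤ a) :
    ‖(1 / 2 : ℝ) • (X + Y)‖ ≤ Real.sqrt (2 * N + 1) * a := by
  refine (norm_le_sqrt_mul_norm_toL2 (smul_mem_S _ (add_mem hX hY))).trans ?_
  gcongr
  rw [map_smul, map_add, norm_smul, Real.norm_of_nonneg (by norm_num)]
  linarith [norm_add_le (toL2 X) (toL2 Y)]

theorem norm_half_smul_add_le' {X Y : Per} {a : ℝ} (hXa : ‖X‖ ≤ a) (hYa : ‖Y‖ ≤ a) :
    ‖(1 / 2 : ℝ) • (X + Y)‖ ≤ a := by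
  rw [norm_smul, Real.norm_of_nonneg (by norm_num)]
  linarith [norm_add_le X Y]

theorem abs_mul_mul_le_of_le {k β b G E G' E' κ : ℝ} (hk : 0 ≤ k) (hb : |b| ≤ β) (hG : 0 ≤ G)
    (hE : 0 ≤ E) (hGG : G ≤ G') (hEE : E ≤ E') (h : k * β * (G' ^ 2 + G' * E') / 2 ≤ κ) :
    |k * b| * (G ^ 2 + G * E) / 2 ≤ κ := by
  refine le_trans ?_ h
  rw [abs_mul, abs_of_nonneg hk]
  have : 0 ≤ β := (abs_nonneg b).trans hb
  have : 0 ≤ G' := hG.trans hGG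
  gcongr

/-- Boundedness in the supremum norm of the stages of one step that starts near a smooth `V`: in
`L²` the stages stay within `O(k)` of `V`, since `F(V)` is bounded, and the inverse inequality
applies to the difference. -/
theorem norm_stages_le {N : ℕ} {s k G B β Q a : ℝ} {q : ℕ} {b : Fin q → ℝ}
    {Z : Fin (q + 1) → Per} {V : Per} (hk : 0 ≤ k) (hb : ∀ j, |b j| ≤ β)
    (hZ : IsStages N s k b Z) (hV : V ∈ S N) (hVG : ‖V‖ ≤ G) (hVB : ‖toL2 V‖ ≤ B)
    (hZB : ‖toL2 (Z 0)‖ ≤ B) (hQ : ‖toL2 (F N s V)‖ ≤ Q) (ha : ‖toL2 (Z 0 - V)‖ ≤ a)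
    (hsmall : k * β * (G ^ 2 + G * (Real.sqrt (2 * N + 1) * (2 * B))) / 2 ≤ 1 / 3)
    (hβ : 0 ≤ β) (j : Fin (q + 1)) :
    ‖Z j‖ ≤ G + Real.sqrt (2 * N + 1) * (2 ^ q * (a + 2 * (k * β * Q))) := by
  have hd : ∀ j, ‖toL2 (Z j - V)‖ ≤ 2 * B := by
    intro j
    rw [map_sub]
    linarith [norm_sub_le (toL2 (Z j)) (toL2 V), norm_toL2_stages hZ j]
  have hG0 : 0 ≤ G := (norm_nonneg _).trans hVG
  have hB0 : 0 ≤ B := (norm_nonneg _).trans hVB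
  have hQ0 : 0 ≤ Q := (norm_nonneg _).trans hQ
  have ha0 : 0 ≤ a := (norm_nonneg _).trans ha
  have hrec : ∀ j : Fin (q + 1), ‖toL2 (Z j - V)‖ + 2 * (k * β * Q) ≤
      2 ^ (j : ℕ) * (a + 2 * (k * β * Q)) := by
    intro j
    induction j using Fin.induction with
    | zero => simpa using ha
    | succ j ih =>
      have hVV : (1 / 2 : ℝ) • (V + V) = V := by module
      have hstep := norm_toL2_step_sub_le (hZ.mem j.castSucc) (hZ.mem j.succ) hV hV (hZ.step j)
        (r := (k * b j) • F N s V) (by rw [hVV, add_sub_cancel_right]) (by rwa [hVV])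
        (norm_half_smul_add_le (sub_mem (hZ.mem _) hV) (sub_mem (hZ.mem _) hV) (hd _) (hd _))
        (abs_mul_mul_le_of_le hk (hb j) hG0 (by positivity) le_rfl le_rfl hsmall) le_rfl
      have hr : ‖toL2 ((k * b j) • F N s V)‖ ≤ k * β * Q := by
        rw [map_smul, norm_smul, norm_mul, Real.norm_of_nonneg hk]
        have := hb j
        rw [Real.norm_eq_abs]
        gcongr
      simp only [Fin.val_succ, Fin.val_castSucc] at ih ⊢
      rw [pow_succ]
      linarith
  have h1 : ‖toL2 (Z j - V)‖ ≤ 2 ^ q * (a + 2 * (k * β * Q)) := by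
    have h2 : (2 : ℝ) ^ (j : ℕ) ≤ 2 ^ q := pow_le_pow_right₀ one_le_two (Nat.lt_succ_iff.mp j.2)
    have h3 := mul_le_mul_of_nonneg_right h2 (by positivity : 0 ≤ a + 2 * (k * β * Q))
    have h4 : 0 ≤ k * β * Q := by positivity
    linarith [hrec j]
  have h2 := norm_le_sqrt_mul_norm_toL2 (sub_mem (hZ.mem j) hV)
  have h3 := norm_add_le V (Z j - V)
  rw [add_sub_cancel] at h3
  have h4 := mul_le_mul_of_nonneg_left h1 (Real.sqrt_nonneg (2 * N + 1))
  linarith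

/-- Stability of one step around bounded stages `Z`, given a bound `E` in the supremum norm for the
difference of the midpoints. -/
theorem norm_toL2_stages_sub_le {N : ℕ} {s k G E κ β : ℝ} {q : ℕ} {b : Fin q → ℝ}
    {Y Z : Fin (q + 1) → Per} (hk : 0 ≤ k) (hb : ∀ j, |b j| ≤ β) (hY : IsStages N s k b Y)
    (hZ : IsStages N s k b Z) (hG : ∀ j, ‖Z j‖ ≤ G)
    (hE : ∀ j : Fin q, ‖(1 / 2 : ℝ) • ((Y j.succ - Z j.succ) + (Y j.castSucc - Z j.castSucc))‖ ≤ E)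
    (hκ : k * β * (G ^ 2 + G * E) / 2 ≤ κ) (hκ0 : 0 ≤ κ) (hκ3 : κ ≤ 1 / 3) (j : Fin (q + 1)) :
    ‖toL2 (Y j - Z j)‖ ≤ (1 + 3 * κ) ^ (j : ℕ) * ‖toL2 (Y 0 - Z 0)‖ := by
  have hG0 : 0 ≤ G := (norm_nonneg _).trans (hG 0)
  induction j using Fin.induction with
  | zero => simp
  | succ j ih =>
    have hstep := norm_toL2_step_sub_le (hY.mem j.castSucc) (hY.mem j.succ) (hZ.mem _) (hZ.mem _)
      (hY.step j) (r := 0) (by rw [sub_zero]; exact hZ.step j)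
      (norm_half_smul_add_le' (hG _) (hG _)) (hE j)
      (abs_mul_mul_le_of_le hk (hb j) hG0 ((norm_nonneg _).trans (hE j)) le_rfl le_rfl hκ) hκ3
    rw [map_zero, norm_zero, mul_zero, add_zero] at hstep
    refine hstep.trans ?_
    simp only [Fin.val_succ, Fin.val_castSucc] at ih ⊢
    rw [pow_succ', mul_assoc]
    gcongr

/-- Two-level stability of one step: a crude growth factor `2` per stage comes from the a priori
bound on the difference of the midpoints by mass conservation; it makes the difference of the
midpoints at most `1` in the supremum norm, which improves the growth factor. -/
theorem norm_toL2_stages_last_sub_le {N : ℕ} {s k G B β : ℝ} {q : ℕ} {b : Fin q → ℝ}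
    {Y Z : Fin (q + 1) → Per} (hk : 0 ≤ k) (hβ : 0 ≤ β) (hb : ∀ j, |b j| ≤ β)
    (hY : IsStages N s k b Y) (hZ : IsStages N s k b Z) (hG : ∀ j, ‖Z j‖ ≤ G)
    (hYB : ‖toL2 (Y 0)‖ ≤ B) (hZB : ‖toL2 (Z 0)‖ ≤ B)
    (hsmall : k * β * (G ^ 2 + G * (Real.sqrt (2 * N + 1) * (2 * B))) / 2 ≤ 1 / 3)
    (hsmall' : k * β * (G ^ 2 + G) / 2 ≤ 1 / 3)
    (hd : Real.sqrt (2 * N + 1) * (2 ^ q * ‖toL2 (Y 0 - Z 0)‖) ≤ 1) :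
    ‖toL2 (Y (Fin.last q) - Z (Fin.last q))‖ ≤
      Real.exp (3 * q * (k * β * (G ^ 2 + G) / 2)) * ‖toL2 (Y 0 - Z 0)‖ := by
  have hG0 : 0 ≤ G := (norm_nonneg _).trans (hG 0)
  have hmem : ∀ j, Y j - Z j ∈ S N := fun j => sub_mem (hY.mem j) (hZ.mem j)
  have hB : ∀ j, ‖toL2 (Y j - Z j)‖ ≤ 2 * B := by
    intro j
    rw [map_sub]
    linarith [norm_sub_le (toL2 (Y j)) (toL2 (Z j)), norm_toL2_stages hY j, norm_toL2_stages hZ j]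
  have hcrude : ∀ j, ‖toL2 (Y j - Z j)‖ ≤ 2 ^ q * ‖toL2 (Y 0 - Z 0)‖ := by
    intro j
    have h := norm_toL2_stages_sub_le hk hb hY hZ hG
      (fun j => norm_half_smul_add_le (hmem _) (hmem _) (hB _) (hB _)) hsmall (by norm_num) le_rfl j
    refine h.trans (mul_le_mul_of_nonneg_right ?_ (norm_nonneg _))
    rw [show (1 : ℝ) + 3 * (1 / 3) = 2 by norm_num]
    exact pow_le_pow_right₀ one_le_two (Nat.lt_succ_iff.mp j.2)
  set κ := k * β * (G ^ 2 + G) / 2 with hκ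
  have hκ0 : 0 ≤ κ := by positivity
  have h := norm_toL2_stages_sub_le hk hb hY hZ hG (E := 1)
    (fun j => (norm_half_smul_add_le (hmem _) (hmem _) (hcrude _) (hcrude _)).trans hd)
    (by rw [mul_one]) hκ0 hsmall' (Fin.last q)
  refine h.trans (mul_le_mul_of_nonneg_right ?_ (norm_nonneg _))
  rw [Fin.val_last, show 3 * (q : ℝ) * κ = q * (3 * κ) by ring, Real.exp_nat_mul]
  gcongr
  linarith [Real.add_one_le_exp (3 * κ)]

/-- A discrete Gronwall inequality in which the recursion is only known below a threshold that
the resulting bound respects. -/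
theorem discrete_gronwall_of_le {M : ℕ} {e : Fin (M + 1) → ℝ} {θ σ D : ℝ} (hθ : 0 ≤ θ) (hσ : 0 ≤ σ)
    (h0 : e 0 = 0) (hD : M * θ * Real.exp (M * σ) ≤ D)
    (h : ∀ n : Fin M, e n.castSucc ≤ D → e n.succ ≤ Real.exp σ * e n.castSucc + θ)
    (n : Fin (M + 1)) : e n ≤ M * θ * Real.exp (M * σ) := by
  have hmono : ∀ n : Fin (M + 1), (n : ℕ) * θ * Real.exp ((n : ℕ) * σ) ≤
      M * θ * Real.exp (M * σ) := by
    intro n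
    have : ((n : ℕ) : ℝ) ≤ M := by exact_mod_cast Nat.lt_succ_iff.mp n.2
    gcongr
  suffices hs : e n ≤ (n : ℕ) * θ * Real.exp ((n : ℕ) * σ) from hs.trans (hmono n)
  induction n using Fin.induction with
  | zero => simp [h0]
  | succ n ih =>
    refine (h n (ih.trans ((hmono _).trans hD))).trans ?_
    simp only [Fin.val_castSucc, Fin.val_succ] at ih ⊢
    have h1 : (1 : ℝ) ≤ Real.exp (((n : ℕ) + 1 : ℕ) * σ) :=
      Real.one_le_exp (by positivity)
    have h2 : Real.exp (((n : ℕ) + 1 : ℕ) * σ) = Real.exp σ * Real.exp ((n : ℕ) * σ) := by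
      rw [← Real.exp_add]
      push_cast
      ring_nf
    have h3 := mul_le_mul_of_nonneg_left ih (Real.exp_pos σ).le
    have h4 := mul_le_mul_of_nonneg_left h1 hθ
    rw [h2] at h4 ⊢
    push_cast
    linarith

/-- Error of the fully discrete scheme with respect to values `x n` in `S N` that satisfy the scheme
up to `θ` and are `a`-close to smooth `V n`. -/
theorem norm_toL2_fullyDiscrete_sub_le {N : ℕ} {s k G G' B β Q a θ : ℝ} {q : ℕ} {b : Fin q → ℝ}
    {M : ℕ} {u₀ : Per} {U : Fin (M + 1) → Per} {Y Z : Fin M → Fin (q + 1) → Per}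
    {x : Fin (M + 1) → Per} {V : Fin M → Per} (hk : 0 ≤ k) (hβ : 0 ≤ β) (hb : ∀ j, |b j| ≤ β)
    (hU : IsFullyDiscrete N s k b u₀ U Y) (hZ : ∀ n, IsStages N s k b (Z n))
    (hZx : ∀ n, Z n 0 = x n.castSucc) (hx0 : x 0 = U 0)
    (hθ : ∀ n : Fin M, ‖toL2 (x n.succ - Z n (Fin.last q))‖ ≤ θ) (hθ0 : 0 ≤ θ)
    (hV : ∀ n, V n ∈ S N) (hVG : ∀ n, ‖V n‖ ≤ G) (hVB : ∀ n, ‖toL2 (V n)‖ ≤ B)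
    (hUB : ∀ n, ‖toL2 (U n)‖ ≤ B) (hxB : ∀ n, ‖toL2 (x n)‖ ≤ B)
    (hQ : ∀ n, ‖toL2 (F N s (V n))‖ ≤ Q) (ha : ∀ n, ‖toL2 (x n.castSucc - V n)‖ ≤ a)
    (hGG : G ≤ G')
    (hG' : G + Real.sqrt (2 * N + 1) * (2 ^ q * (a + 2 * (k * β * Q))) ≤ G')
    (hsmall : k * β * (G' ^ 2 + G' * (Real.sqrt (2 * N + 1) * (2 * B))) / 2 ≤ 1 / 3)
    (hsmall' : k * β * (G' ^ 2 + G') / 2 ≤ 1 / 3)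
    (hθsmall : Real.sqrt (2 * N + 1) * (2 ^ q *
      (M * θ * Real.exp (M * (3 * q * (k * β * (G' ^ 2 + G') / 2))))) ≤ 1) (n : Fin (M + 1)) :
    ‖toL2 (U n - x n)‖ ≤ M * θ * Real.exp (M * (3 * q * (k * β * (G' ^ 2 + G') / 2))) := by
  rcases Nat.eq_zero_or_pos M with hM | hM
  · subst hM
    rw [show n = 0 from Fin.ext (by omega), hx0, sub_self]
    simp
  have hG0 : 0 ≤ G := (norm_nonneg _).trans (hVG ⟨0, hM⟩)
  have hG'0 : 0 ≤ G' := hG0.trans hGG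
  have hB0 : 0 ≤ B := (norm_nonneg _).trans (hUB 0)
  refine discrete_gronwall_of_le (e := fun n => ‖toL2 (U n - x n)‖) hθ0 (by positivity)
    (by simp [hx0]) le_rfl (fun n hn => ?_) n
  have hZG : ∀ j, ‖Z n j‖ ≤ G' := by
    intro j
    refine (norm_stages_le hk hb (hZ n) (hV n) (hVG n) (hVB n) ?_ (hQ n) ?_ ?_ hβ j).trans hG'
    · rw [hZx]
      exact hxB _
    · rw [hZx]
      exact ha n
    · exact le_trans (by gcongr) hsmall
  have hYZ := norm_toL2_stages_last_sub_le hk hβ hb (hU.stages n) (hZ n) hZG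
    (by rw [hU.start]; exact hUB _) (by rw [hZx]; exact hxB _) hsmall hsmall' (by
      rw [hU.start, hZx]
      exact le_trans (by gcongr) hθsmall)
  rw [hU.start, hZx, ← hU.next] at hYZ
  have e : U n.succ - x n.succ = (U n.succ - Z n (Fin.last q)) - (x n.succ - Z n (Fin.last q)) := by
    abel
  rw [e, map_sub]
  exact (norm_sub_le _ _).trans (add_le_add hYZ (hθ n))

/-! ### Convergence -/

/-- Error of the semidiscretization for large `N`, with an explicit constant. -/
theorem norm_toL2_semidiscrete_sub_proj_le_of_large {s T μ B D : ℝ} {N : ℕ} {u₀ : Per}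
    {u uN : ℝ → Per} (hμ : 1 ≤ μ) (hT : 0 ≤ T) (h : IsSolution s T u₀ u)
    (hB : ∀ t ∈ Set.Icc 0 T, MemSobolev μ (u t) ∧ sobolevNorm μ (u t) ≤ B)
    (hN : IsSemidiscrete N s T u₀ uN) (hN1 : 1 ≤ N)
    (hD : D = (3 * sobolevSupBound B ^ 2 * B + 1) *
      Real.exp ((2 * (sobolevSupBound B ^ 2 + sobolevSupBound B) + 2) * T / 2))
    (hsmall : Real.sqrt (2 * N + 1) * (D * (N : ℝ) ^ (-μ)) ≤ 1) {t : ℝ} (ht : t ∈ Set.Icc 0 T) :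
    ‖toL2 (uN t - proj N (u t))‖ ≤ D * (N : ℝ) ^ (-μ) := by
  have hN0 : (0 : ℝ) < N := by exact_mod_cast hN1
  have hB0 : 0 ≤ B := (Real.sqrt_nonneg _).trans (hB 0 ⟨le_rfl, hT⟩).2
  set G := sobolevSupBound B
  set A := (N : ℝ) ^ (-μ) with hA
  have hA0 : 0 < A := by positivity
  have hDA : D * A = (3 * G ^ 2 * B + 1) * A * Real.exp ((2 * (G ^ 2 + G) + 2) * T / 2) := by
    rw [hD]; ring
  rw [hDA] at hsmall ⊢
  refine norm_toL2_semidiscrete_sub_proj_le h hN hT hA0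
    (fun t ht => norm_proj_le_sobolevSupBound hμ (hB t ht).1 (hB t ht).2 N) (by positivity)
    (fun t ht => ?_) rfl hsmall ht
  refine (norm_toL2_cubic_sub_le (norm_le_sobolevSupBound hμ (hB t ht).1 (hB t ht).2)
    (norm_proj_le_sobolevSupBound hμ (hB t ht).1 (hB t ht).2 N)).trans ?_
  have h1 := norm_toL2_sub_proj_le (by linarith) (hB t ht).1 hN1
  have h2 := mul_le_mul_of_nonneg_left (hB t ht).2 hA0.le
  calc 3 * G ^ 2 * ‖toL2 (u t - proj N (u t))‖ ≤ 3 * G ^ 2 * (A * B) := by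
        gcongr
        exact h1.trans h2
    _ = _ := by ring

/-- Both admissible values of `R` dominate the norm of `P_N u₀` in the normalized `L²` space. -/
theorem norm_toL2_proj_le_of_restriction {N : ℕ} {s T R : ℝ} {u₀ : Per} {uN : ℝ → Per}
    (hT : 0 ≤ T) (hN : IsSemidiscrete N s T u₀ uN)
    (hR : R = l2norm (proj N u₀) ∨ IsGreatest ((fun t => ‖uN t‖) '' Set.Icc 0 T) R) :
    ‖toL2 (proj N u₀)‖ ≤ R := by
  rcases hR with hR | hR
  · rw [hR, l2norm_eq]
    refine le_mul_of_one_le_left (norm_nonneg _) (Real.one_le_sqrt.mpr ?_)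
    linarith [Real.pi_gt_three]
  · rw [← hN.init]
    exact (norm_toL2_le_norm _).trans (hR.2 ⟨0, ⟨le_rfl, hT⟩, rfl⟩)

/-- The step restriction implies the contraction condition of the stage equations. -/
theorem unique_solvability_restriction {N : ℕ} (hN : 1 ≤ N) {k β ρ R : ℝ} (hk : 0 ≤ k)
    (hρ : 0 ≤ ρ) (hR : ρ ≤ R) (h : 3 * R ^ 2 * k * N * |β| < 1) :
    |k * β| * (2 * N + 1) * ρ ^ 2 < 1 := by
  have hN1 : (1 : ℝ) ≤ N := by exact_mod_cast hN
  refine lt_of_le_of_lt ?_ h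
  rw [abs_mul, abs_of_nonneg hk]
  calc k * |β| * (2 * N + 1) * ρ ^ 2 ≤ k * |β| * (3 * N) * R ^ 2 := by
        gcongr
        linarith
    _ = _ := by ring

/-- With `k N` bounded, the constant of the inverse inequality times `k` is `O(√k)`. -/
theorem sqrt_two_mul_add_one_mul_le {N : ℕ} (hN : 1 ≤ N) {k J : ℝ} (hk : 0 ≤ k) (hJ : 0 ≤ J)
    (hkN : 3 * (k * N) ≤ J ^ 2) : Real.sqrt (2 * N + 1) * k ≤ J * Real.sqrt k := by
  have hN1 : (1 : ℝ) ≤ N := by exact_mod_cast hN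
  refine le_of_sq_le_sq ?_ (by positivity)
  rw [mul_pow, mul_pow, Real.sq_sqrt (by positivity), Real.sq_sqrt hk]
  nlinarith

/-- Error of the fully discrete scheme with respect to the semidiscrete solution, for `k` small
compared with the constants of the problem and `k N` bounded by `J² / 3`. -/
theorem norm_toL2_fullyDiscrete_sub_semidiscrete_le {s : ℝ} (hs0 : 0 < s) (hs1 : s ≤ 1)
    {q : ℕ} {b : Fin q → ℝ} {α : ℕ} (hα : 1 ≤ α) {μ : ℝ} (hμ : 2 ≤ μ) {T : ℝ} (hT : 0 < T)
    {u₀ : Per} {u : ℝ → Per} {B G G' Q β J D a CΘ k : ℝ}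
    (hB : ∀ t ∈ Set.Icc 0 T, MemSobolev μ (u t) ∧ sobolevNorm μ (u t) ≤ B)
    (hG : G = sobolevSupBound B) (hG0 : 0 ≤ G) (hQ : Q = B + sobolevSupBound B ^ 2 * B)
    (hbβ : ∀ j, |b j| ≤ β) (hβ0 : 0 ≤ β) (hJ0 : 0 ≤ J)
    (hG' : G' = G + 2 ^ q * (1 + 2 * β * Q * J)) (hC : 0 ≤ CΘ)
    (hD : D = T * CΘ * Real.exp (T * (3 * q * (β * (G' ^ 2 + G') / 2))))
    {N M : ℕ} (hN1 : 1 ≤ N) {uN : ℝ → Per} (hN : IsSemidiscrete N s T u₀ uN)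
    (hPB : ‖toL2 (proj N u₀)‖ ≤ B)
    (hsemi : ∀ t ∈ Set.Icc 0 T, ‖toL2 (uN t - proj N (u t))‖ ≤ a)
    (hca : Real.sqrt (2 * N + 1) * a ≤ 1) (hk : 0 < k) (hTk : T = M * k)
    (hkN : 3 * (k * N) ≤ J ^ 2) (hsk1 : Real.sqrt k ≤ 1)
    (hp1 : Real.sqrt k * (3 * β * (G' ^ 2 + G' * (J * (2 * B))) / 2) ≤ 1)
    (hp2 : Real.sqrt k * (3 * β * (G' ^ 2 + G') / 2) ≤ 1)
    (hp3 : Real.sqrt k * (2 ^ q * D * J) ≤ 1)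
    (hsolv : ∀ j, |k * b j| * (2 * N + 1) * ‖toL2 (proj N u₀)‖ ^ 2 < 1)
    (hΘ : ∀ (n : Fin M) (Z : Fin (q + 1) → Per),
      IsStages N s k b Z → Z 0 = uN ((n : ℝ) * k) →
      ‖toL2 (uN (((n : ℝ) + 1) * k) - Z (Fin.last q))‖ ≤ CΘ * k ^ (α + 1))
    {U : Fin (M + 1) → Per} {Y : Fin M → Fin (q + 1) → Per} (hU : IsFullyDiscrete N s k b u₀ U Y)
    (n : Fin (M + 1)) : ‖toL2 (U n - uN ((n : ℕ) * k))‖ ≤ D * k ^ α := by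
  have hB0 : 0 ≤ B := (norm_nonneg _).trans hPB
  have hQ0 : 0 ≤ Q := by rw [hQ]; positivity
  have hGG' : G ≤ G' := by rw [hG']; linarith [show 0 ≤ 2 ^ q * (1 + 2 * β * Q * J) by positivity]
  have hG'0 : 0 ≤ G' := hG0.trans hGG'
  have hD0 : 0 ≤ D := by rw [hD]; positivity
  have htn : ∀ n : Fin (M + 1), ((n : ℕ) : ℝ) * k ∈ Set.Icc 0 T := by
    intro n
    have : ((n : ℕ) : ℝ) ≤ M := by exact_mod_cast Nat.lt_succ_iff.mp n.2
    refine ⟨by positivity, ?_⟩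
    rw [hTk]
    gcongr
  obtain ⟨c, hc⟩ : ∃ c, c = Real.sqrt (2 * N + 1) := ⟨_, rfl⟩
  have hc0 : 0 ≤ c := by rw [hc]; exact Real.sqrt_nonneg _
  rw [← hc] at hca
  have hck : c * k ≤ J * Real.sqrt k := by
    rw [hc]
    exact sqrt_two_mul_add_one_mul_le hN1 hk.le hJ0 hkN
  have hk1 : k ≤ 1 := Real.sqrt_le_one.mp hsk1
  have hksk : k ≤ Real.sqrt k := by
    rw [Real.le_sqrt' hk]
    nlinarith
  have hck' : c * k ≤ J := hck.trans (mul_le_of_le_one_right hJ0 hsk1)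
  have hstage := fun n : Fin M => (existsUnique_stages s hsolv
    (hN.mem _ (htn n.castSucc)) (norm_toL2_semidiscrete hN (htn n.castSucc)).le).exists
  choose Z hZ hZ0 using hstage
  have hsum : M * (CΘ * k ^ (α + 1)) *
      Real.exp (M * (3 * q * (k * β * (G' ^ 2 + G') / 2))) = D * k ^ α := by
    rw [hD, hTk, pow_succ]
    ring_nf
  rw [← hsum]
  refine norm_toL2_fullyDiscrete_sub_le (G := G) (B := B) (Q := Q) (a := a)
    (x := fun n => uN ((n : ℕ) * k)) (V := fun n => proj N (u ((n : ℕ) * k)))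
    hk.le hβ0 hbβ hU hZ hZ0 ?_ ?_ (by positivity) (fun _ => proj_mem N _) ?_ ?_ ?_ ?_ ?_ ?_
    hGG' ?_ ?_ ?_ ?_ n
  · simp only [Fin.val_zero, Nat.cast_zero, zero_mul]
    rw [hN.init, hU.init]
  · intro n
    have := hΘ n (Z n) (hZ n) (hZ0 n)
    simpa only [Fin.val_succ, Nat.cast_add, Nat.cast_one] using this
  · intro n
    rw [hG]
    have h1 := hB _ (htn n.castSucc)
    exact norm_proj_le_sobolevSupBound (by linarith) h1.1 h1.2 N
  · intro n
    have h1 := hB _ (htn n.castSucc)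
    exact (norm_toL2_proj_le N _).trans
      ((norm_toL2_le_sobolevNorm (by linarith) h1.1).trans h1.2)
  · intro n
    rw [norm_toL2_fullyDiscrete hU]
    exact hPB
  · intro n
    rw [norm_toL2_semidiscrete hN (htn n)]
    exact hPB
  · intro n
    rw [hQ]
    have h1 := hB _ (htn n.castSucc)
    exact norm_toL2_F_proj_le hs0.le (by linarith) (by linarith) h1.1 h1.2 N
  · intro n
    exact hsemi _ (htn n.castSucc)
  · rw [← hc, hG']
    have h1 : c * (2 ^ q * (a + 2 * (k * β * Q))) =
        2 ^ q * (c * (a) + 2 * β * Q * (c * k)) := by ring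
    rw [h1]
    gcongr
  · rw [← hc]
    have h1 : k * β * (G' ^ 2 + G' * (c * (2 * B))) / 2 =
        β * (k * G' ^ 2 + G' * ((c * k) * (2 * B))) / 2 := by ring
    have h2 : β * (k * G' ^ 2 + G' * ((c * k) * (2 * B))) / 2 ≤
        β * (Real.sqrt k * G' ^ 2 + G' * ((J * Real.sqrt k) * (2 * B))) / 2 := by gcongr
    rw [h1]
    linarith
  · have h2 : k * β * (G' ^ 2 + G') / 2 ≤ Real.sqrt k * β * (G' ^ 2 + G') / 2 := by gcongr
    linarith
  · rw [hsum, ← hc]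
    have h1 : k ^ α ≤ k := pow_le_of_le_one hk.le hk1 (by omega)
    calc c * (2 ^ q * (D * k ^ α)) ≤ c * (2 ^ q * (D * k)) := by gcongr
      _ = 2 ^ q * D * (c * k) := by ring
      _ ≤ 2 ^ q * D * (J * Real.sqrt k) := by gcongr
      _ ≤ 1 := by linarith

/-- The error estimate for `N ≥ X` and `√k Ξ ≤ 1`, in the normalized `L²` norm; the constants
depend on `s`, `q`, `b`, `α`, `μ`, `T`, `u₀`, `u` and `CΘ` only. -/
theorem exists_error_bound_of_large (s : ℝ) (hs0 : 0 < s) (hs1 : s ≤ 1)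
    (q : ℕ) (hq : 1 ≤ q) (b : Fin q → ℝ) (hb : ∀ j, b j ≠ 0)
    (α : ℕ) (hα : 1 ≤ α) (μ : ℝ) (hμ : 2 ≤ μ) (T : ℝ) (hT : 0 < T) (u₀ : Per) (u : ℝ → Per)
    (hu : IsSolution s T u₀ u) (B : ℝ)
    (hB : ∀ t ∈ Set.Icc 0 T, MemSobolev μ (u t) ∧ sobolevNorm μ (u t) ≤ B) (CΘ : ℝ) (hC : 0 ≤ CΘ) :
    ∃ C X : ℝ, ∃ Ξ > (0 : ℝ), ∀ N : ℕ, 1 ≤ N → X ≤ N →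
      ∀ uN : ℝ → Per, IsSemidiscrete N s T u₀ uN →
      ∀ R : ℝ, ‖toL2 (proj N u₀)‖ ≤ R →
      ∀ (M : ℕ) (k : ℝ), 0 < k → T = M * k → Real.sqrt k * Ξ ≤ 1 →
        (∀ j, 3 * R ^ 2 * k * N * |b j| < 1) →
        (∀ (n : Fin M) (Z : Fin (q + 1) → Per),
          IsStages N s k b Z → Z 0 = uN ((n : ℝ) * k) →
          ‖toL2 (uN (((n : ℝ) + 1) * k) - Z (Fin.last q))‖ ≤ CΘ * k ^ (α + 1)) →
        ∀ (U : Fin (M + 1) → Per) (Y : Fin M → Fin (q + 1) → Per),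
          IsFullyDiscrete N s k b u₀ U Y →
          ∀ n : Fin (M + 1),
            ‖toL2 (U n - u ((n : ℝ) * k))‖ ≤ C * (k ^ α + (N : ℝ) ^ (-μ)) := by
  have h0T : (0 : ℝ) ∈ Set.Icc 0 T := ⟨le_rfl, hT.le⟩
  have hB0 : 0 ≤ B := (Real.sqrt_nonneg _).trans (hB 0 h0T).2
  have hu₀B : ‖toL2 u₀‖ ≤ B := by
    rw [← hu.init]
    exact (norm_toL2_le_sobolevNorm (by linarith) (hB 0 h0T).1).trans (hB 0 h0T).2
  obtain ⟨G, hG⟩ : ∃ G, G = sobolevSupBound B := ⟨_, rfl⟩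
  have hG0 : 0 ≤ G := by
    rw [hG]
    exact (norm_nonneg _).trans
      (norm_le_sobolevSupBound (by linarith) (hB 0 h0T).1 (hB 0 h0T).2)
  obtain ⟨D₁, hD₁⟩ : ∃ D, D = (3 * sobolevSupBound B ^ 2 * B + 1) *
    Real.exp ((2 * (sobolevSupBound B ^ 2 + sobolevSupBound B) + 2) * T / 2) := ⟨_, rfl⟩
  have hD₁0 : 0 ≤ D₁ := by rw [hD₁]; positivity
  obtain ⟨Q, hQ⟩ : ∃ Q, Q = B + sobolevSupBound B ^ 2 * B := ⟨_, rfl⟩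
  have hQ0 : 0 ≤ Q := by rw [hQ]; positivity
  obtain ⟨β, hβ⟩ : ∃ β, β = ∑ j, |b j| := ⟨_, rfl⟩
  have hβ0 : 0 ≤ β := by rw [hβ]; exact Finset.sum_nonneg fun _ _ => abs_nonneg _
  have hbβ : ∀ j, |b j| ≤ β := fun j => by
    rw [hβ]
    exact Finset.single_le_sum (f := fun j => |b j|) (fun _ _ => abs_nonneg _) (Finset.mem_univ j)
  let j₀ : Fin q := ⟨0, hq⟩
  have hb₀ : 0 < |b j₀| := abs_pos.mpr (hb j₀)
  obtain ⟨r, hr⟩ : ∃ r, r = ‖toL2 u₀‖ := ⟨_, rfl⟩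
  have hr0 : 0 ≤ r := by rw [hr]; exact norm_nonneg _
  -- `R ≥ ‖P_N u₀‖ ≥ r / 2` for large `N`, so the step restriction gives `3 k N ≤ J²` if `u₀ ≠ 0`
  obtain ⟨J, hJ⟩ : ∃ J, J = Real.sqrt (4 / (r ^ 2 * |b j₀|)) := ⟨_, rfl⟩
  have hJ0 : 0 ≤ J := by rw [hJ]; exact Real.sqrt_nonneg _
  obtain ⟨G', hG'⟩ : ∃ G', G' = G + 2 ^ q * (1 + 2 * β * Q * J) := ⟨_, rfl⟩
  have hGG' : G ≤ G' := by rw [hG']; linarith [show 0 ≤ 2 ^ q * (1 + 2 * β * Q * J) by positivity]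
  have hG'0 : 0 ≤ G' := hG0.trans hGG'
  obtain ⟨D, hD⟩ : ∃ D, D = T * CΘ * Real.exp (T * (3 * q * (β * (G' ^ 2 + G') / 2))) := ⟨_, rfl⟩
  have hD0 : 0 ≤ D := by rw [hD]; positivity
  -- the terms of the threshold for `N` serve `√(2N+1) D₁ N^{-μ} ≤ 1` and `‖P_N u₀‖ ≥ r / 2`; the
  -- quotient is `0` if `u₀ = 0`, where it is not used
  refine ⟨D + (B + D₁), 1 + 3 * D₁ ^ 2 + 2 * B / r, 1 + 3 * β * (G' ^ 2 + G' * (J * (2 * B))) / 2 +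
    3 * β * (G' ^ 2 + G') / 2 + 2 ^ q * D * J, by positivity, ?_⟩
  intro N hN1 hNX uN hN R hρR M k hk hTk hkΞ hR hΘ U Y hU n
  have hNr : (1 : ℝ) ≤ N := by exact_mod_cast hN1
  obtain ⟨A, hA⟩ : ∃ A, A = (N : ℝ) ^ (-μ) := ⟨_, rfl⟩
  have hA0 : 0 ≤ A := by rw [hA]; positivity
  have hA1 : A ≤ (N : ℝ)⁻¹ := by
    rw [hA, ← Real.rpow_neg_one]
    exact Real.rpow_le_rpow_of_exponent_le hNr (by linarith)
  obtain ⟨c, hc⟩ : ∃ c, c = Real.sqrt (2 * N + 1) := ⟨_, rfl⟩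
  have hc0 : 0 ≤ c := by rw [hc]; exact Real.sqrt_nonneg _
  have hc2 : c ^ 2 = 2 * N + 1 := by rw [hc]; exact Real.sq_sqrt (by positivity)
  have hBr : 0 ≤ 2 * B / r := by positivity
  have hcA : c * (D₁ * A) ≤ 1 := by
    have h1 : c * (D₁ * A) ≤ c * (D₁ * (N : ℝ)⁻¹) := by gcongr
    refine h1.trans (le_of_sq_le_sq ?_ zero_le_one)
    rw [mul_pow, hc2, mul_pow, inv_pow, ← mul_assoc, ← div_eq_mul_inv, one_pow,
      div_le_one (by positivity)]
    nlinarith [sq_nonneg D₁]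
  have hsemi : ∀ t ∈ Set.Icc 0 T, ‖toL2 (uN t - proj N (u t))‖ ≤ D₁ * A := by
    intro t ht
    rw [hA]
    exact norm_toL2_semidiscrete_sub_proj_le_of_large (by linarith) hT.le hu hB hN hN1 hD₁
      (by rw [← hc, ← hA]; exact hcA) ht
  have hspec : ∀ t ∈ Set.Icc 0 T, ‖toL2 (u t - proj N (u t))‖ ≤ B * A := by
    intro t ht
    refine (norm_toL2_sub_proj_le (by linarith) (hB t ht).1 hN1).trans ?_
    rw [← hA, mul_comm]
    exact mul_le_mul_of_nonneg_right (hB t ht).2 hA0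
  have htn : ∀ n : Fin (M + 1), ((n : ℕ) : ℝ) * k ∈ Set.Icc 0 T := by
    intro n
    have : ((n : ℕ) : ℝ) ≤ M := by exact_mod_cast Nat.lt_succ_iff.mp n.2
    refine ⟨by positivity, ?_⟩
    rw [hTk]
    gcongr
  have hPB : ‖toL2 (proj N u₀)‖ ≤ B := (norm_toL2_proj_le N u₀).trans hu₀B
  have hmain : ‖toL2 (U n - uN ((n : ℕ) * k))‖ ≤ D * k ^ α := by
    rcases hr0.eq_or_lt with hr00 | hr00
    · -- if `u₀ = 0`, then `U n` and `u^N` vanish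
      have h0 : ‖toL2 (proj N u₀)‖ = 0 := le_antisymm
        ((norm_toL2_proj_le N u₀).trans (by rw [← hr, ← hr00])) (norm_nonneg _)
      have h1 := norm_toL2_fullyDiscrete hU n
      have h2 := norm_toL2_semidiscrete hN (htn n)
      rw [map_sub]
      refine (norm_sub_le _ _).trans ?_
      rw [h1, h2, h0, add_zero]
      positivity
    · have hρ : r / 2 ≤ ‖toL2 (proj N u₀)‖ := by
        have h1 := hspec 0 h0T
        rw [hu.init, map_sub] at h1
        have h2 := norm_sub_norm_le (toL2 u₀) (toL2 (proj N u₀))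
        have h3 : B * A ≤ r / 2 := by
          have h4 : B * A ≤ B * (N : ℝ)⁻¹ := by gcongr
          refine h4.trans ?_
          rw [← div_eq_mul_inv, div_le_div_iff₀ (by positivity) two_pos]
          have h5 : 2 * B / r ≤ N := by linarith [show 0 ≤ 3 * D₁ ^ 2 by positivity]
          rw [div_le_iff₀ hr00] at h5
          linarith
        rw [← hr] at h2
        linarith
      have hkN : 3 * (k * N) ≤ J ^ 2 := by
        rw [hJ, Real.sq_sqrt (by positivity), le_div_iff₀ (by positivity)]
        have h1 : (r / 2) ^ 2 ≤ R ^ 2 := by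
          gcongr
          exact hρ.trans hρR
        have h2 : 3 * (r / 2) ^ 2 * k * N * |b j₀| ≤ 3 * R ^ 2 * k * N * |b j₀| := by gcongr
        linarith [hR j₀]
      have hsk0 : 0 ≤ Real.sqrt k := Real.sqrt_nonneg k
      have hp1 : 0 ≤ Real.sqrt k * (3 * β * (G' ^ 2 + G' * (J * (2 * B))) / 2) := by positivity
      have hp2 : 0 ≤ Real.sqrt k * (3 * β * (G' ^ 2 + G') / 2) := by positivity
      have hp3 : 0 ≤ Real.sqrt k * (2 ^ q * D * J) := by positivity
      rw [mul_add, mul_add, mul_add, mul_one] at hkΞ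
      refine norm_toL2_fullyDiscrete_sub_semidiscrete_le hs0 hs1 hα hμ hT hB hG hG0 hQ hbβ hβ0 hJ0
        hG' hC hD hN1 hN hPB hsemi (hc ▸ hcA) hk hTk hkN ?_ ?_ ?_ ?_
        (fun j => unique_solvability_restriction hN1 hk.le (norm_nonneg _) hρR (hR j)) hΘ hU n
      all_goals linarith
  have h1 := hsemi _ (htn n)
  have h2 := hspec _ (htn n)
  have e : U n - u ((n : ℕ) * k) = (U n - uN ((n : ℕ) * k)) +
      ((uN ((n : ℕ) * k) - proj N (u ((n : ℕ) * k))) -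
        (u ((n : ℕ) * k) - proj N (u ((n : ℕ) * k)))) := by abel
  rw [e, map_add, map_sub toL2 (uN _ - _)]
  have h3 := norm_add_le (toL2 (U n - uN ((n : ℕ) * k)))
    (toL2 (uN ((n : ℕ) * k) - proj N (u ((n : ℕ) * k))) -
      toL2 (u ((n : ℕ) * k) - proj N (u ((n : ℕ) * k))))
  have h4 := norm_sub_le (toL2 (uN ((n : ℕ) * k) - proj N (u ((n : ℕ) * k))))
      (toL2 (u ((n : ℕ) * k) - proj N (u ((n : ℕ) * k))))
  rw [← hA]
  have h5 : 0 ≤ D * A := by positivity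
  have h6 : 0 ≤ (B + D₁) * k ^ α := by positivity
  linarith

end FNLS

end

theorem theorem3p3 (s : ℝ) (hs0 : 0 < s) (hs1 : s ≤ 1)
    (q : ℕ) (hq : 1 ≤ q) (b : Fin q → ℝ) (hb : ∀ j, b j ≠ 0)
    (α : ℕ) (hα : 1 ≤ α) :
    ∃ μ₀ : ℝ, ∀ μ : ℝ, μ₀ ≤ μ →
      ∀ (T : ℝ), 0 < T →
      ∀ (u₀ : FNLS.Per) (u : ℝ → FNLS.Per),
        FNLS.IsSolution s T u₀ u → FNLS.BoundedInSobolev μ T u →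
      ∀ CΘ : ℝ, ∃ C : ℝ,
      ∀ N : ℕ, 1 ≤ N → ∀ uN : ℝ → FNLS.Per, FNLS.IsSemidiscrete N s T u₀ uN →
      ∀ R : ℝ, (R = FNLS.l2norm (FNLS.proj N u₀) ∨
          IsGreatest ((fun t => ‖uN t‖) '' Set.Icc 0 T) R) →
      ∀ (M : ℕ) (k : ℝ), 1 ≤ M → 0 < k → T = M * k →
        (∀ j, 3 * R ^ 2 * k * N * |b j| < 1) →
        (∀ (n : Fin M) (Z : Fin (q + 1) → FNLS.Per),
          FNLS.IsStages N s k b Z → Z 0 = uN ((n : ℝ) * k) →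
          FNLS.l2norm (uN (((n : ℝ) + 1) * k) - Z (Fin.last q)) ≤ CΘ * k ^ (α + 1)) →
        (∃! W : (Fin (M + 1) → FNLS.Per) × (Fin M → Fin (q + 1) → FNLS.Per),
          FNLS.IsFullyDiscrete N s k b u₀ W.1 W.2) ∧
        ∀ (U : Fin (M + 1) → FNLS.Per) (Y : Fin M → Fin (q + 1) → FNLS.Per),
          FNLS.IsFullyDiscrete N s k b u₀ U Y →
          ∀ n : Fin (M + 1),
            FNLS.l2norm (U n - u ((n : ℝ) * k)) ≤ C * (k ^ α + (N : ℝ) ^ (-μ)) := by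
  refine ⟨2, fun μ hμ T hT u₀ u hu ⟨B, hB⟩ CΘ => ?_⟩
  obtain ⟨C, X, Ξ, hΞ, hlarge⟩ := FNLS.exists_error_bound_of_large s hs0 hs1 q hq b hb α hα μ hμ T hT
    u₀ u hu B hB |CΘ| (abs_nonneg _)
  have hL2 : ∀ t ∈ Set.Icc 0 T, ‖FNLS.toL2 (u t)‖ ≤ B := fun t ht =>
    (FNLS.norm_toL2_le_sobolevNorm (by linarith) (hB t ht).1).trans (hB t ht).2
  have h0T : (0 : ℝ) ∈ Set.Icc 0 T := ⟨le_rfl, hT.le⟩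
  have hB0 : 0 ≤ B := (norm_nonneg _).trans (hL2 0 h0T)
  have hμ0 : 0 ≤ μ := by linarith
  set X' := max X 1 with hX'
  have hX'0 : 0 < X' := lt_max_of_lt_right one_pos
  have hpi : 1 ≤ Real.sqrt (2 * Real.pi) := Real.one_le_sqrt.mpr (by linarith [Real.pi_gt_three])
  have hpi0 : 0 ≤ Real.sqrt (2 * Real.pi) := zero_le_one.trans hpi
  refine ⟨Real.sqrt (2 * Real.pi) * (|C| + 2 * B * (Ξ ^ 2) ^ α + 2 * B * X' ^ μ), ?_⟩
  intro N hN1 uN hN R hR M k hM hk hTk hRk hΘ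
  have hN0 : (0 : ℝ) < N := by exact_mod_cast hN1
  have hρR := FNLS.norm_toL2_proj_le_of_restriction hT.le hN hR
  refine ⟨FNLS.existsUnique_fullyDiscrete s (fun j => FNLS.unique_solvability_restriction hN1 hk.le
    (norm_nonneg _) hρR (hRk j)) M le_rfl, fun U Y hU n => ?_⟩
  rw [FNLS.l2norm_eq, mul_assoc]
  refine mul_le_mul_of_nonneg_left ?_ hpi0
  set A := (N : ℝ) ^ (-μ) with hA
  have hA0 : 0 ≤ A := by positivity
  have hkα : 0 ≤ k ^ α := by positivity
  have hc1 : 0 ≤ |C| * (k ^ α + A) := by positivity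
  have hc2 : 0 ≤ 2 * B * (Ξ ^ 2) ^ α * (k ^ α + A) := by positivity
  have hc3 : 0 ≤ 2 * B * X' ^ μ * (k ^ α + A) := by positivity
  have htn : ((n : ℕ) : ℝ) * k ∈ Set.Icc 0 T := by
    have : ((n : ℕ) : ℝ) ≤ M := by exact_mod_cast Nat.lt_succ_iff.mp n.2
    refine ⟨by positivity, ?_⟩
    rw [hTk]
    gcongr
  have htriv : ‖FNLS.toL2 (U n - u ((n : ℕ) * k))‖ ≤ 2 * B := by
    rw [map_sub]
    have h1 := norm_sub_le (FNLS.toL2 (U n)) (FNLS.toL2 (u ((n : ℕ) * k)))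
    have h2 := FNLS.norm_toL2_fullyDiscrete hU n
    have h3 := FNLS.norm_toL2_proj_le N u₀
    have h4 := hL2 _ h0T
    rw [hu.init] at h4
    linarith [hL2 _ htn]
  by_cases hNX : X ≤ N
  · by_cases hkΞ : Real.sqrt k * Ξ ≤ 1
    · have h := hlarge N hN1 hNX uN hN R hρR M k hk hTk hkΞ hRk (fun n Z hZ hZ0 => by
        have h1 := hΘ n Z hZ hZ0
        rw [FNLS.l2norm_eq] at h1
        refine (le_mul_of_one_le_left (norm_nonneg _) hpi).trans (h1.trans ?_)
        gcongr
        exact le_abs_self _) U Y hU n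
      have h2 : C * (k ^ α + A) ≤ |C| * (k ^ α + A) := by
        gcongr
        exact le_abs_self _
      linarith
    · -- `k` is bounded below, and the error is bounded by conservation of mass
      have h1 : 1 ≤ k * Ξ ^ 2 := by
        have := one_le_pow₀ (not_le.mp hkΞ).le (n := 2)
        rwa [mul_pow, Real.sq_sqrt hk.le] at this
      have h2 : 1 ≤ (Ξ ^ 2) ^ α * (k ^ α + A) := by
        have h3 := one_le_pow₀ h1 (n := α)
        rw [mul_pow] at h3
        have h4 : 0 ≤ (Ξ ^ 2) ^ α * A := by positivity
        linarith
      have h5 := mul_le_mul_of_nonneg_left h2 (by positivity : 0 ≤ 2 * B)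
      linarith
  · -- `N` is bounded above, and the error is bounded by conservation of mass
    have h1 : 1 ≤ X' ^ μ * A := by
      have h2 : (N : ℝ) ≤ X' := (not_le.mp hNX).le.trans (le_max_left _ _)
      calc (1 : ℝ) = (N : ℝ) ^ μ * A := by
            rw [hA, ← Real.rpow_add hN0, add_neg_cancel, Real.rpow_zero]
        _ ≤ _ := by gcongr
    have h2 : 1 ≤ X' ^ μ * (k ^ α + A) := by
      have h4 : 0 ≤ X' ^ μ * k ^ α := by positivity
      linarith
    have h5 := mul_le_mul_of_nonneg_left h2 (by positivity : 0 ≤ 2 * B)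
    linarith
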